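/- Let $\dot H^1(\mathbb R^3)$ denote the space of $\phi\in L^6(\mathbb R^3;\mathbb C)$ whose weak gradient lies in $L^2$ (equivalently, the completion of $C_0^\infty(\mathbb R^3)$ for the norm $\|\nabla\phi\|_{L^2}$), and let $E(\phi,\psi)^2=\int_{\mathbb R^3}(|\nabla\phi|^2+|\psi|^2)\,dz$ be the energy of $(\phi,\psi)\in \dot H^1(\mathbb R^3)\times L^2(\mathbb R^3)$. For $\phi,\psi\in C_0^\infty(\mathbb R^3)$ let $u$ be the smooth solution of $(\partial_t^2-\Delta)u=0$ on $\mathbb R\times\mathbb R^3$ with $u(0,\cdot)=\phi$, $\partial_tu(0,\cdot)=\psi$, and let $$\mathcal R_+(\phi,\psi,0)(s,\theta)=\lim_{r\to\infty} r\,(\partial_tu)(s+r,r\theta),\qquad (s,\theta)\in\mathbb R\times\mathbb S^2,$$ be its forward radiation field. Denote also by $\mathcal R_+(\cdot,\cdot,0):\dot H^1(\mathbb R^3)\times L^2(\mathbb R^3)\to L^2(\mathbb R\times\mathbb S^2)$ the extension of this map by continuity with respect to the energy norm. Let $R\in\mathbb R$, let $F\in L^2(\mathbb R;\mathbb C)$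 be supported in $\{|s|\le R\}$, and suppose that $\int_{\mathbb R}F(s)\,ds=0$. Regard $F$ as a function on $\mathbb R\times\mathbb S^2$ that does not depend on $\theta$. Then there exist $(\phi,\psi)\in \dot H^1(\mathbb R^3)\times L^2(\mathbb R^3)$ with $\mathcal R_+(\phi,\psi,0)=F$ in $L^2(\mathbb R\times\mathbb S^2)$, and for every such pair $\phi$ and $\psi$ are radial functions with finite energy and $\phi(z)=\psi(z)=0$ for almost every $z$ with $|z|\ge R$. -/

import Mathlib

open MeasureTheory Filter Topology
open scoped ContDiff

noncomputable section

/-- Physical space `ℝ³` with its Euclidean norm. -/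
abbrev Space3 : Type := EuclideanSpace ℝ (Fin 3)

/-- The unit sphere `𝕊²`. -/
abbrev Sphere2 : Type := Metric.sphere (0 : Space3) 1

/-- Lebesgue measure times surface measure on the cylinder `ℝ × 𝕊²`. -/
def cylinderMeasure : Measure (ℝ × Sphere2) :=
  (volume : Measure ℝ).prod (volume : Measure Space3).toSphere

/-- `χ ∈ C₀^∞(ℝ³)`. -/
def IsTestFunction (χ : Space3 → ℂ) : Prop :=
  ContDiff ℝ ∞ χ ∧ HasCompactSupport χ

/-- The classical gradient `(∂₁φ, ∂₂φ, ∂₃φ)` of a complex valued function. -/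
def gradient3 (φ : Space3 → ℂ) (z : Space3) : EuclideanSpace ℂ (Fin 3) :=
  WithLp.toLp 2 fun i => fderiv ℝ φ z (EuclideanSpace.single i 1)

/-- `g` is the gradient of `φ` in the sense of distributions. -/
structure HasWeakGradient (φ : Space3 → ℂ) (g : Space3 → EuclideanSpace ℂ (Fin 3)) : Prop where
  locallyIntegrable : LocallyIntegrable φ volume
  locallyIntegrable_grad : LocallyIntegrable g volume
  integral_eq : ∀ χ : Space3 → ℂ, IsTestFunction χ → ∀ i : Fin 3,
    ∫ z, φ z * gradient3 χ z i = - ∫ z, g z i * χ z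

/-- `φ ∈ Ḣ¹(ℝ³)`: the weak gradient of `φ` is in `L²`. The condition `φ ∈ L⁶` selects, among the
functions that differ from `φ` by a constant, the one that lies in the completion of `C₀^∞(ℝ³)`
for the norm `‖∇φ‖_{L²}`. -/
def MemHomogeneousSobolev (φ : Space3 → ℂ) : Prop :=
  MemLp φ 6 volume ∧ ∃ g, HasWeakGradient φ g ∧ MemLp g 2 volume

/-- `(φ, ψ) ∈ Ḣ¹(ℝ³) × L²(ℝ³)`. -/
def FiniteEnergy (φ ψ : Space3 → ℂ) : Prop :=
  MemHomogeneousSobolev φ ∧ MemLp ψ 2 volume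

/-- `(φₙ, ψₙ) → (φ, ψ)` in the energy norm `E(φ, ψ)² = ∫ |∇φ|² + |ψ|²`, for differentiable `φₙ`
and data `(φ, ψ)` of finite energy. -/
def TendstoInEnergy (φn ψn : ℕ → Space3 → ℂ) (φ ψ : Space3 → ℂ) : Prop :=
  (∃ g, HasWeakGradient φ g ∧ MemLp g 2 volume ∧
    Tendsto (fun n => eLpNorm (fun z => gradient3 (φn n) z - g z) 2 volume) atTop (𝓝 0)) ∧
  Tendsto (fun n => eLpNorm (fun z => ψn n z - ψ z) 2 volume) atTop (𝓝 0)

/-- `u = u(t, z)` is a smooth solution of `(∂ₜ² - Δ) u = 0` on `ℝ × ℝ³` with Cauchy data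
`u(0, ·) = φ`, `∂ₜ u(0, ·) = ψ`. -/
structure IsWaveSolution (φ ψ : Space3 → ℂ) (u : ℝ × Space3 → ℂ) : Prop where
  contDiff : ContDiff ℝ ∞ u
  wave_eq : ∀ (t : ℝ) (z : Space3),
    iteratedDeriv 2 (fun τ : ℝ => u (τ, z)) t =
      Laplacian.laplacian (fun y : Space3 => u (t, y)) z
  initial_value : ∀ z, u (0, z) = φ z
  initial_velocity : ∀ z, deriv (fun τ : ℝ => u (τ, z)) 0 = ψ z

/-- `G = 𝓡₊(φ, ψ, 0)` for smooth data: `G(s, θ) = lim_{r → ∞} r (∂ₜ u)(s + r, r θ)` for the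
solution `u` of the wave equation with data `(φ, ψ)`. -/
def IsClassicalRadiationField (φ ψ : Space3 → ℂ) (G : ℝ × Sphere2 → ℂ) : Prop :=
  ∃ u : ℝ × Space3 → ℂ, IsWaveSolution φ ψ u ∧
    ∀ (s : ℝ) (θ : Sphere2),
      Tendsto (fun r : ℝ => (r : ℂ) * deriv (fun τ : ℝ => u (τ, r • (θ : Space3))) (s + r))
        atTop (𝓝 (G (s, θ)))

/-- `G = 𝓡₊(φ, ψ, 0)` in `L²(ℝ × 𝕊²)` for `(φ, ψ) ∈ Ḣ¹ × L²`, where `𝓡₊` is the extension by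
continuity, from `C₀^∞ × C₀^∞` to the energy space, of the classical radiation field: `G` is the
`L²` limit of the radiation fields of test data that converge to `(φ, ψ)` in energy. -/
def IsRadiationField (φ ψ : Space3 → ℂ) (G : ℝ × Sphere2 → ℂ) : Prop :=
  FiniteEnergy φ ψ ∧ MemLp G 2 cylinderMeasure ∧
  ∃ (φn ψn : ℕ → Space3 → ℂ) (Gn : ℕ → ℝ × Sphere2 → ℂ),
    (∀ n, IsTestFunction (φn n) ∧ IsTestFunction (ψn n)) ∧
    TendstoInEnergy φn ψn φ ψ ∧
    (∀ n, IsClassicalRadiationField (φn n) (ψn n) (Gn n)) ∧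
    Tendsto (fun n => eLpNorm (fun p => Gn n p - G p) 2 cylinderMeasure) atTop (𝓝 0)

/-- `f` agrees almost everywhere with a function of `|z|`. -/
def IsRadial (f : Space3 → ℂ) : Prop :=
  ∃ h : ℝ → ℂ, ∀ᵐ z, f z = h ‖z‖

end

/-!
The solution `u` with data `(φ, ψ)` satisfies the strong Huygens principle, so at time `t` it lives
in a shell `| |z| - t | ≤ a`, where the `1 / t` decay given by Kirchhoff's formula turns
`∫ |∂ₜ u(t)|²` into an approximation of `‖𝓡₊(φ, ψ, 0)‖²` as `t → ∞`. On the other hand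
`N(t) = ∫ |u(t)|² ≥ 0` has second derivative `4 ∫ |∂ₜ u(t)|² - 2 E²`, which therefore cannot have a
negative limit: `E² ≤ 2 ‖𝓡₊(φ, ψ, 0)‖²`. Hence `𝓡₊` is injective, and data whose radiation fields
converge in `L²` converge in energy.

It remains to construct one pair of radial data supported in the ball of radius `R`. If `K` is
smooth, of mean zero and supported in `[-b, b]`, then `K` has a primitive `g` supported there, and
the superposition of the plane waves `K(t + ⟨z, ω⟩)` over the sphere is a multiple of the radial
wave `(g(t + r) - g(t - r)) / r`. Its data vanish for `r > b` and its radiation field is a multiple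
of `K`. A general `F` is the `L²` limit of such functions `K` with `b → R`.
-/

section DirectionalDerivative

/-- The directional derivative `∂_v f` as an operator on functions. -/
noncomputable def dirDeriv {V F : Type*} [NormedAddCommGroup V] [NormedSpace ℝ V]
    [NormedAddCommGroup F] [NormedSpace ℝ F] (v : V) (f : V → F) (x : V) : F :=
  fderiv ℝ f x v

variable {V W F : Type*} [NormedAddCommGroup V] [NormedSpace ℝ V]
  [NormedAddCommGroup W] [NormedSpace ℝ W] [NormedAddCommGroup F] [NormedSpace ℝ F]
  {f g : V → F}

theorem contDiff_dirDeriv (hf : ContDiff ℝ ∞ f) (v : V) : ContDiff ℝ ∞ (dirDeriv v f) :=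
  (hf.fderiv_right (m := ∞) (by simp)).clm_apply contDiff_const

theorem hasCompactSupport_dirDeriv (hf : HasCompactSupport f) (v : V) :
    HasCompactSupport (dirDeriv v f) :=
  hf.fderiv_apply ℝ v

theorem dirDeriv_dirDeriv (hf : ContDiff ℝ ∞ f) (v w x : V) :
    dirDeriv v (dirDeriv w f) x = fderiv ℝ (fderiv ℝ f) x v w := by
  have hd : Differentiable ℝ (fderiv ℝ f) :=
    (hf.fderiv_right (m := ∞) (by simp)).differentiable (by simp)
  change fderiv ℝ (fun y => fderiv ℝ f y w) x v = _
  simp [fderiv_clm_apply (hd x) (differentiableAt_const w)]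

theorem dirDeriv_comm (hf : ContDiff ℝ ∞ f) (v w : V) :
    dirDeriv v (dirDeriv w f) = dirDeriv w (dirDeriv v f) := by
  funext x
  have hsymm : IsSymmSndFDerivAt ℝ f x := hf.contDiffAt.isSymmSndFDerivAt (by
    rw [minSmoothness_of_isRCLikeNormedField]
    exact (mod_cast le_top : ((2 : ℕ∞) : WithTop ℕ∞) ≤ ∞))
  rw [dirDeriv_dirDeriv hf, dirDeriv_dirDeriv hf, hsymm.eq]

theorem dirDeriv_neg_left (v : V) (f : V → F) :
    dirDeriv (-v) f = fun x => -dirDeriv v f x :=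
  funext fun x => map_neg (fderiv ℝ f x) v

theorem dirDeriv_translate (f : V → F) (z v : V) :
    dirDeriv v (fun y => f (z + y)) = fun y => dirDeriv v f (z + y) := by
  funext y
  simp only [dirDeriv, fderiv_comp_add_left]

theorem dirDeriv_sub (hf : ContDiff ℝ ∞ f) (hg : ContDiff ℝ ∞ g) (v : V) :
    dirDeriv v (fun x => f x - g x) = fun x => dirDeriv v f x - dirDeriv v g x := by
  funext x
  simp only [dirDeriv]
  rw [fderiv_fun_sub (hf.differentiable (by simp) x) (hg.differentiable (by simp) x)]
  rfl

theorem dirDeriv_sum {ι : Type*} (s : Finset ι) {f : ι → V → F} (hf : ∀ i, ContDiff ℝ ∞ (f i))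
    (v : V) : dirDeriv v (fun x => ∑ i ∈ s, f i x) = fun x => ∑ i ∈ s, dirDeriv v (f i) x := by
  funext x
  simp only [dirDeriv]
  rw [fderiv_fun_sum fun i _ => (hf i).differentiable (by simp) x, sum_apply]

theorem hasDerivAt_comp_curve (hf : ContDiff ℝ ∞ f) {γ : ℝ → V} {v : V} {s : ℝ}
    (hγ : HasDerivAt γ v s) : HasDerivAt (fun s => f (γ s)) (dirDeriv v f (γ s)) s :=
  (hf.differentiable (by simp) (γ s)).hasFDerivAt.comp_hasDerivAt s hγ

theorem dirDeriv_comp (hf : ContDiff ℝ ∞ f) {g : W → V} {g' : W →L[ℝ] V} {x : W}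
    (hg : HasFDerivAt g g' x) (w : W) :
    dirDeriv w (fun x => f (g x)) x = dirDeriv (g' w) f (g x) := by
  have h := ((hf.differentiable (by simp) (g x)).hasFDerivAt.comp x hg).fderiv
  simp only [Function.comp_def] at h
  simp [dirDeriv, h]

section RadialFunctions

variable {E : Type*} [NormedAddCommGroup E] {g : ℝ → F}

omit [NormedSpace ℝ F] in
theorem comp_norm_eventuallyEq_zero (hs : tsupport g ⊆ Set.Ioi 0) :
    (fun y : E => g ‖y‖) =ᶠ[𝓝 0] fun _ => 0 := by
  have h0 : g =ᶠ[𝓝 0] 0 := notMem_tsupport_iff_eventuallyEq.1 fun h => lt_irrefl (0 : ℝ) (hs h)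
  have hnorm : Tendsto (fun y : E => ‖y‖) (𝓝 0) (𝓝 0) := by
    simpa using (continuous_norm (E := E)).tendsto 0
  exact hnorm.eventually h0

omit [NormedSpace ℝ F] in
theorem hasCompactSupport_comp_norm [ProperSpace E] (hg : HasCompactSupport g) :
    HasCompactSupport fun y : E => g ‖y‖ := by
  obtain ⟨b, hb⟩ := hg.isCompact.isBounded.subset_closedBall 0
  refine HasCompactSupport.of_support_subset_isCompact (isCompact_closedBall (0 : E) b) ?_
  intro y hy
  simpa using hb (subset_tsupport g hy)

variable [InnerProductSpace ℝ E] (hg : ContDiff ℝ ∞ g) (hs : tsupport g ⊆ Set.Ioi 0)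
include hg hs

theorem contDiff_comp_norm : ContDiff ℝ ∞ (fun y : E => g ‖y‖) := by
  refine contDiff_iff_contDiffAt.2 fun y => ?_
  rcases eq_or_ne y 0 with rfl | hy
  · exact contDiffAt_const.congr_of_eventuallyEq (comp_norm_eventuallyEq_zero hs)
  · exact hg.contDiffAt.comp y (contDiffAt_norm ℝ hy)

theorem dirDeriv_comp_norm (v y : E) :
    dirDeriv v (fun y : E => g ‖y‖) y = (‖y‖⁻¹ * inner ℝ y v) • deriv g ‖y‖ := by
  rcases eq_or_ne y 0 with rfl | hy
  · simp [dirDeriv, (comp_norm_eventuallyEq_zero (E := E) hs).fderiv_eq]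
  have h1 : HasFDerivAt (fun y : E => ‖y‖) (‖y‖⁻¹ • innerSL ℝ y) y := by
    have h := (hasStrictFDerivAt_norm_sq y).hasFDerivAt.sqrt
      (pow_ne_zero 2 (norm_ne_zero_iff.2 hy))
    simp only [Real.sqrt_sq (norm_nonneg _)] at h
    convert h using 1
    match_scalars
    field_simp
  have h2 := ((hg.differentiable (by simp) ‖y‖).hasDerivAt.hasFDerivAt.comp y h1).fderiv
  simp only [Function.comp_def] at h2
  simp [dirDeriv, h2, mul_smul]

end RadialFunctions

section IntegrationByParts

variable {G H : Type*} [NormedAddCommGroup G] [NormedSpace ℝ G] [NormedAddCommGroup H]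
  [NormedSpace ℝ H] [MeasurableSpace V] [BorelSpace V] [FiniteDimensional ℝ V]
  {μ : Measure V} [μ.IsAddHaarMeasure]

theorem integral_bilin_dirDeriv (B : F →L[ℝ] G →L[ℝ] H) {f : V → F} {g : V → G}
    (hf : ContDiff ℝ ∞ f) (hg : ContDiff ℝ ∞ g) (hfs : HasCompactSupport f) (v : V) :
    ∫ x, B (f x) (dirDeriv v g x) ∂μ = - ∫ x, B (dirDeriv v f x) (g x) ∂μ := by
  have h_int : ∀ {f : V → F} {g : V → G}, ContDiff ℝ ∞ f → ContDiff ℝ ∞ g → HasCompactSupport f →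
      Integrable (fun x => B (f x) (g x)) μ := fun hf hg hfs =>
    ((B.continuous.comp hf.continuous).clm_apply hg.continuous).integrable_of_hasCompactSupport
      (hfs.mono fun x hx hfx => hx (by simp [hfx]))
  exact integral_bilinear_fderiv_right_eq_neg_left_of_integrable
    (h_int (contDiff_dirDeriv hf v) hg (hasCompactSupport_dirDeriv hfs v))
    (h_int hf (contDiff_dirDeriv hg v) hfs) (h_int hf hg hfs)
    (fun x _ => hf.differentiable (by simp) x) (fun x _ => hg.differentiable (by simp) x)

theorem eqOn_dirDeriv_of_integral_smul {U : Set V} (hU : IsOpen U) {f h : V → F} [CompleteSpace F]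
    (hf : ContDiff ℝ ∞ f) (hh : Continuous h) (v : V)
    (hfh : ∀ g : V → ℝ, ContDiff ℝ ∞ g → HasCompactSupport g → tsupport g ⊆ U →
      ∫ x, g x • h x ∂μ = - ∫ x, dirDeriv v g x • f x ∂μ) :
    Set.EqOn h (dirDeriv v f) U := by
  have hf' := (contDiff_dirDeriv hf v).continuous
  have hae : ∀ᵐ x ∂μ, x ∈ U → h x - dirDeriv v f x = 0 := by
    refine hU.ae_eq_zero_of_integral_contDiff_smul_eq_zero
      ((hh.sub hf').locallyIntegrable.locallyIntegrableOn _) fun g hg hgc hgU => ?_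
    have hparts := integral_bilin_dirDeriv (μ := μ) (ContinuousLinearMap.lsmul ℝ ℝ) hg hf hgc v
    simp only [ContinuousLinearMap.lsmul_apply] at hparts
    simp only [smul_sub]
    rw [integral_sub, hfh g hg hgc hgU, hparts, sub_self]
    · exact (hg.continuous.smul hh).integrable_of_hasCompactSupport hgc.smul_right
    · exact (hg.continuous.smul hf').integrable_of_hasCompactSupport hgc.smul_right
  refine Measure.eqOn_open_of_ae_eq (μ := μ) ?_ hU hh.continuousOn hf'.continuousOn
  refine (ae_restrict_iff' hU.measurableSet).2 (hae.mono fun x hx hxU => ?_)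
  exact sub_eq_zero.1 (hx hxU)

end IntegrationByParts

end DirectionalDerivative

section SphereIntegral

variable {V E F : Type*} [NormedAddCommGroup V] [NormedSpace ℝ V]
  [NormedAddCommGroup E] [NormedSpace ℝ E] [FiniteDimensional ℝ E] [MeasurableSpace E]
  [BorelSpace E] {μ : Measure E} [μ.IsAddHaarMeasure] [NormedAddCommGroup F] [NormedSpace ℝ F]

omit [NormedSpace ℝ F] in
theorem integrable_sphere_of_continuous {f : Metric.sphere (0 : E) 1 → F} (hf : Continuous f) :
    Integrable f μ.toSphere :=
  hf.integrable_of_hasCompactSupport (HasCompactSupport.of_compactSpace f)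

theorem hasFDerivAt_sphere_integral [ProperSpace V] {f : V × E → F} (hf : ContDiff ℝ 1 f) (x : V) :
    HasFDerivAt (fun x => ∫ θ : Metric.sphere (0 : E) 1, f (x, θ) ∂μ.toSphere)
      (∫ θ : Metric.sphere (0 : E) 1,
        (fderiv ℝ f (x, θ)).comp (ContinuousLinearMap.inl ℝ V E) ∂μ.toSphere) x := by
  set f' : V → Metric.sphere (0 : E) 1 → V →L[ℝ] F := fun x θ =>
    (fderiv ℝ f (x, (θ : E))).comp (ContinuousLinearMap.inl ℝ V E)
  have hc : Continuous f := hf.continuous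
  have hc' : Continuous fun p : V × Metric.sphere (0 : E) 1 => f' p.1 p.2 := by
    have := hf.continuous_fderiv one_ne_zero
    fun_prop
  obtain ⟨M, hM⟩ := ((isCompact_closedBall x 1).prod
    (isCompact_univ (X := Metric.sphere (0 : E) 1))).bddAbove_image hc'.norm.continuousOn
  refine hasFDerivAt_integral_of_dominated_of_fderiv_le (s := Metric.closedBall x 1)
    (bound := fun _ => M) (F' := f') (Metric.closedBall_mem_nhds x one_pos)
    (Eventually.of_forall fun y => ?_) ?_ ?_ ?_ (integrable_const M) ?_
  · exact Continuous.aestronglyMeasurable (by fun_prop)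
  · exact integrable_sphere_of_continuous (by fun_prop)
  · exact (hc'.comp (Continuous.prodMk_right x)).aestronglyMeasurable
  · exact Eventually.of_forall fun θ y hy => hM ⟨(y, θ), ⟨hy, Set.mem_univ θ⟩, rfl⟩
  · exact Eventually.of_forall fun θ y _ =>
      (hf.differentiable one_ne_zero (y, (θ : E))).hasFDerivAt.comp y
        (hasFDerivAt_prodMk_left y (θ : E))

theorem dirDeriv_sphere_integral [ProperSpace V] {f : V × E → F}
    (hf : ContDiff ℝ ∞ f) (v : V) :
    dirDeriv v (fun x => ∫ θ : Metric.sphere (0 : E) 1, f (x, θ) ∂μ.toSphere) =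
      fun x => ∫ θ : Metric.sphere (0 : E) 1, dirDeriv (v, 0) f (x, θ) ∂μ.toSphere := by
  funext x
  have hf' := hf.continuous_fderiv (by simp)
  rw [dirDeriv, (hasFDerivAt_sphere_integral (hf.of_le (by exact_mod_cast le_top)) x).fderiv,
    ContinuousLinearMap.integral_apply (integrable_sphere_of_continuous (by fun_prop))]
  simp [dirDeriv]

theorem contDiff_sphere_integral [FiniteDimensional ℝ V] {f : V × E → F}
    (hf : ContDiff ℝ ∞ f) :
    ContDiff ℝ ∞ (fun x => ∫ θ : Metric.sphere (0 : E) 1, f (x, θ) ∂μ.toSphere) := by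
  have : ProperSpace V := FiniteDimensional.proper_real V
  have hdiff : ∀ {f : V × E → F}, ContDiff ℝ ∞ f →
      Differentiable ℝ fun x => ∫ θ : Metric.sphere (0 : E) 1, f (x, θ) ∂μ.toSphere := fun hf x =>
    (hasFDerivAt_sphere_integral (hf.of_le (by exact_mod_cast le_top)) x).differentiableAt
  refine contDiff_infty.2 fun n => ?_
  induction n generalizing f with
  | zero => exact contDiff_zero.2 (hdiff hf).continuous
  | succ n ih =>
    rw [Nat.cast_succ, contDiff_succ_iff_fderiv_apply]
    refine ⟨hdiff hf, by simp, fun v => ?_⟩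
    have h := ih (contDiff_dirDeriv hf (v, 0))
    rwa [← dirDeriv_sphere_integral hf] at h

end SphereIntegral

section PolarCoordinates

variable {E : Type*} [NormedAddCommGroup E] [NormedSpace ℝ E] [FiniteDimensional ℝ E]
  [MeasurableSpace E] [BorelSpace E]

theorem measurableEmbedding_polar :
    MeasurableEmbedding
      (fun p : Metric.sphere (0 : E) 1 × Set.Ioi (0 : ℝ) => (p.2 : ℝ) • (p.1 : E)) :=
  (MeasurableEmbedding.subtype_coe (measurableSet_singleton (0 : E)).compl).comp
    (homeomorphUnitSphereProd E).symm.measurableEmbedding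

variable [Nontrivial E] (μ : Measure E) [μ.IsAddHaarMeasure]

theorem measurePreserving_polar :
    MeasurePreserving (fun p : Metric.sphere (0 : E) 1 × Set.Ioi (0 : ℝ) => (p.2 : ℝ) • (p.1 : E))
      (μ.toSphere.prod (Measure.volumeIoiPow (Module.finrank ℝ E - 1))) μ := by
  have h1 := (μ.measurePreserving_homeomorphUnitSphereProd).symm
    (homeomorphUnitSphereProd E).toMeasurableEquiv
  have h2 := measurePreserving_subtype_coe (μa := μ) (measurableSet_singleton (0 : E)).compl
  rw [restrict_compl_singleton] at h2
  exact h2.comp h1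

theorem integral_eq_integral_sphere {F : Type*} [NormedAddCommGroup F] [NormedSpace ℝ F]
    {f : E → F} (hf : Integrable f μ) :
    ∫ z, f z ∂μ = ∫ r in Set.Ioi (0 : ℝ), r ^ (Module.finrank ℝ E - 1) •
      ∫ θ : Metric.sphere (0 : E) 1, f (r • (θ : E)) ∂μ.toSphere := by
  have hpolar := measurePreserving_polar μ
  have h_int := (hpolar.integrable_comp_emb measurableEmbedding_polar).2 hf
  simp only [Function.comp_def] at h_int
  rw [← hpolar.integral_comp measurableEmbedding_polar, integral_prod_symm _ h_int]
  simp only [Measure.volumeIoiPow, ENNReal.ofReal]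
  rw [integral_withDensity_eq_integral_smul (by fun_prop),
    integral_subtype_comap measurableSet_Ioi fun r : ℝ => (r ^ (Module.finrank ℝ E - 1)).toNNReal •
      ∫ θ : Metric.sphere (0 : E) 1, f (r • (θ : E)) ∂μ.toSphere]
  refine setIntegral_congr_fun measurableSet_Ioi fun r hr => ?_
  simp only [NNReal.smul_def, Real.coe_toNNReal _ (pow_nonneg (le_of_lt hr) _)]

theorem lintegral_eq_lintegral_sphere {f : E → ENNReal} (hf : Measurable f) :
    ∫⁻ z, f z ∂μ = ∫⁻ θ : Metric.sphere (0 : E) 1, (∫⁻ r in Set.Ioi (0 : ℝ),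
      ENNReal.ofReal (r ^ (Module.finrank ℝ E - 1)) * f (r • (θ : E))) ∂μ.toSphere := by
  rw [← (measurePreserving_polar μ).lintegral_comp_emb measurableEmbedding_polar,
    lintegral_prod _ (by fun_prop)]
  refine lintegral_congr fun θ => ?_
  rw [Measure.volumeIoiPow, lintegral_withDensity_eq_lintegral_mul _ (by fun_prop) (by fun_prop)]
  exact lintegral_subtype_comap measurableSet_Ioi fun r : ℝ =>
    ENNReal.ofReal (r ^ (Module.finrank ℝ E - 1)) * f (r • (θ : E))

end PolarCoordinates

section SphericalMeans

variable {E F : Type*} [NormedAddCommGroup E] [InnerProductSpace ℝ E] [FiniteDimensional ℝ E]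
  [NormedAddCommGroup F] [NormedSpace ℝ F]

theorem laplacian_eq_sum_dirDeriv {ι : Type*} [Fintype ι] (b : OrthonormalBasis ι ℝ E) {f : E → F}
    (hf : ContDiff ℝ ∞ f) :
    Laplacian.laplacian f = fun x => ∑ i, dirDeriv (b i) (dirDeriv (b i) f) x := by
  rw [InnerProductSpace.laplacian_eq_iteratedFDeriv_orthonormalBasis f b]
  funext x
  exact Finset.sum_congr rfl fun i _ => by simp [iteratedFDeriv_two_apply, dirDeriv_dirDeriv hf]

theorem laplacian_translate {f : E → F} (hf : ContDiff ℝ ∞ f) (z : E) :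
    Laplacian.laplacian (fun y => f (z + y)) = fun y => Laplacian.laplacian f (z + y) := by
  rw [laplacian_eq_sum_dirDeriv (stdOrthonormalBasis ℝ E) hf, laplacian_eq_sum_dirDeriv
    (stdOrthonormalBasis ℝ E) (f := fun y => f (z + y)) (hf.comp (by fun_prop))]
  simp only [dirDeriv_translate]

theorem contDiff_laplacian {f : E → F} (hf : ContDiff ℝ ∞ f) :
    ContDiff ℝ ∞ (Laplacian.laplacian f) := by
  rw [laplacian_eq_sum_dirDeriv (stdOrthonormalBasis ℝ E) hf]
  exact ContDiff.sum fun i _ => contDiff_dirDeriv (contDiff_dirDeriv hf _) _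

omit [FiniteDimensional ℝ E] in
theorem norm_smul_sphere {r : ℝ} (hr : 0 ≤ r) (θ : Metric.sphere (0 : E) 1) :
    ‖r • (θ : E)‖ = r := by
  rw [norm_smul, norm_eq_of_mem_sphere, mul_one, Real.norm_of_nonneg hr]

variable [MeasurableSpace E] [BorelSpace E]

variable (E) in
/-- The surface measure of the unit sphere of a Euclidean space. -/
noncomputable abbrev surfaceMeasure : Measure (Metric.sphere (0 : E) 1) :=
  (volume : Measure E).toSphere

/-- The integral of `f` over the sphere of radius `r` with respect to the surface measure of the
unit sphere; it is not normalized. -/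
noncomputable def sphereMean (f : E → F) (r : ℝ) : F :=
  ∫ θ : Metric.sphere (0 : E) 1, f (r • (θ : E)) ∂surfaceMeasure E

variable {f : E → F}

theorem sphereMean_smul (c : ℝ → ℝ) {r : ℝ} (hr : 0 ≤ r) :
    sphereMean (fun y => c ‖y‖ • f y) r = c r • sphereMean f r := by
  simp only [sphereMean, norm_smul_sphere hr, integral_smul]

theorem contDiff_sphereMean (hf : ContDiff ℝ ∞ f) : ContDiff ℝ ∞ (sphereMean f) :=
  contDiff_sphere_integral (f := fun p : ℝ × E => f (p.1 • p.2))
    (hf.comp (contDiff_fst.smul contDiff_snd))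

theorem deriv_sphereMean (hf : ContDiff ℝ ∞ f) (r : ℝ) :
    deriv (sphereMean f) r =
      ∫ θ : Metric.sphere (0 : E) 1, fderiv ℝ f (r • (θ : E)) θ ∂surfaceMeasure E := by
  have h := congr_fun (dirDeriv_sphere_integral (μ := volume) (f := fun p : ℝ × E => f (p.1 • p.2))
    (hf.comp (contDiff_fst.smul contDiff_snd)) 1) r
  refine h.trans (integral_congr_ae (Eventually.of_forall fun θ => ?_))
  have hsmul := (hasFDerivAt_fst (𝕜 := ℝ) (p := (r, (θ : E)))).fun_smul
    (hasFDerivAt_snd (𝕜 := ℝ) (p := (r, (θ : E))))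
  simpa [dirDeriv] using dirDeriv_comp hf hsmul (1, 0)

theorem sphereMean_fderiv_self (hf : ContDiff ℝ ∞ f) (r : ℝ) :
    sphereMean (fun y => fderiv ℝ f y y) r = r • deriv (sphereMean f) r := by
  rw [deriv_sphereMean hf, ← integral_smul]
  simp only [sphereMean, map_smul]

section Darboux

variable {g : ℝ → ℝ} (hg : ContDiff ℝ ∞ g) (hgc : HasCompactSupport g)
  (hgs : tsupport g ⊆ Set.Ioi 0)
include hg hgc hgs

theorem integral_radial_smul_laplacian (hf : ContDiff ℝ ∞ f) :
    ∫ y, g ‖y‖ • Laplacian.laplacian f y =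
      - ∫ y, (‖y‖⁻¹ * deriv g ‖y‖) • fderiv ℝ f y y := by
  set b := stdOrthonormalBasis ℝ E
  have hK : ContDiff ℝ ∞ fun y : E => g ‖y‖ := contDiff_comp_norm hg hgs
  have hKc : HasCompactSupport fun y : E => g ‖y‖ := hasCompactSupport_comp_norm hgc
  have h_int : ∀ {k : E → ℝ}, ContDiff ℝ ∞ k → HasCompactSupport k → ∀ {h : E → F},
      ContDiff ℝ ∞ h → Integrable fun y => k y • h y := fun hk hkc h hh =>
    (hk.continuous.smul hh.continuous).integrable_of_hasCompactSupport hkc.smul_right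
  have hgrad : ∀ y : E, (‖y‖⁻¹ * deriv g ‖y‖) • fderiv ℝ f y y =
      ∑ i, dirDeriv (b i) (fun y : E => g ‖y‖) y • dirDeriv (b i) f y := by
    intro y
    conv_lhs => rw [← b.sum_repr' y, map_sum, Finset.smul_sum]
    refine Finset.sum_congr rfl fun i _ => ?_
    rw [dirDeriv_comp_norm hg hgs, b.sum_repr', map_smul, real_inner_comm, dirDeriv]
    simp only [smul_smul, smul_eq_mul, mul_right_comm]
  simp only [laplacian_eq_sum_dirDeriv b hf, Finset.smul_sum, hgrad]
  rw [integral_finsetSum _ fun i _ => h_int hK hKc (contDiff_dirDeriv (contDiff_dirDeriv hf _) _),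
    integral_finsetSum _ fun i _ => h_int (contDiff_dirDeriv hK _)
      (hasCompactSupport_dirDeriv hKc _) (contDiff_dirDeriv hf _), ← Finset.sum_neg_distrib]
  exact Finset.sum_congr rfl fun i _ => integral_bilin_dirDeriv (ContinuousLinearMap.lsmul ℝ ℝ)
    hK (contDiff_dirDeriv hf _) hKc _

theorem setIntegral_smul_sphereMean_laplacian [Nontrivial E] (hf : ContDiff ℝ ∞ f) :
    ∫ r in Set.Ioi (0 : ℝ), g r • r ^ (Module.finrank ℝ E - 1) •
        sphereMean (Laplacian.laplacian f) r =
      - ∫ r in Set.Ioi (0 : ℝ), deriv g r • r ^ (Module.finrank ℝ E - 1) •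
        deriv (sphereMean f) r := by
  have hK : Continuous fun y : E => g ‖y‖ := hg.continuous.comp continuous_norm
  have hgreen := integral_radial_smul_laplacian hg hgc hgs hf
  have hleft : Integrable fun y => g ‖y‖ • Laplacian.laplacian f y :=
    (hK.smul (contDiff_laplacian hf).continuous).integrable_of_hasCompactSupport
      (hasCompactSupport_comp_norm hgc).smul_right
  have hright : Integrable fun y => (‖y‖⁻¹ * deriv g ‖y‖) • fderiv ℝ f y y := by
    have hqc : HasCompactSupport fun r => r⁻¹ * deriv g r := hgc.deriv.mul_left
    have hq : Continuous fun r => r⁻¹ * deriv g r := continuous_of_tsupport fun r hr =>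
      (continuousAt_inv₀ (hgs (tsupport_deriv_subset (tsupport_mul_subset_right hr))).ne').mul
        (contDiff_infty_iff_deriv.1 hg).2.continuous.continuousAt
    have := hf.continuous_fderiv (by simp)
    exact ((hq.comp continuous_norm).smul (by fun_prop)).integrable_of_hasCompactSupport
      (hasCompactSupport_comp_norm hqc).smul_right
  rw [integral_eq_integral_sphere _ hleft, integral_eq_integral_sphere _ hright] at hgreen
  convert hgreen using 1
  · refine setIntegral_congr_fun measurableSet_Ioi fun r hr => ?_
    change _ = _ • sphereMean (fun y => g ‖y‖ • Laplacian.laplacian f y) r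
    rw [sphereMean_smul g (le_of_lt hr), smul_comm]
  · congr 1
    refine setIntegral_congr_fun measurableSet_Ioi fun r hr => ?_
    change _ = _ • sphereMean (fun y => (‖y‖⁻¹ * deriv g ‖y‖) • fderiv ℝ f y y) r
    rw [sphereMean_smul (fun s => s⁻¹ * deriv g s) (le_of_lt hr), sphereMean_fderiv_self hf]
    have := (Set.mem_Ioi.1 hr).ne'
    match_scalars
    field_simp

end Darboux

theorem euler_poisson_darboux [Nontrivial E] [CompleteSpace F] (hf : ContDiff ℝ ∞ f) {r : ℝ}
    (hr : 0 < r) :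
    deriv (fun r => r ^ (Module.finrank ℝ E - 1) • deriv (sphereMean f) r) r =
      r ^ (Module.finrank ℝ E - 1) • sphereMean (Laplacian.laplacian f) r := by
  have hpow : ContDiff ℝ ∞ fun r : ℝ => r ^ (Module.finrank ℝ E - 1) := contDiff_id.pow _
  have hflux := hpow.smul (contDiff_infty_iff_deriv.1 (contDiff_sphereMean hf)).2
  have hsource := hpow.smul (contDiff_sphereMean (contDiff_laplacian hf))
  refine (eqOn_dirDeriv_of_integral_smul (μ := volume) isOpen_Ioi hflux hsource.continuous (1 : ℝ)
    ?_ hr).symm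
  intro g hg hgc hgs
  have hzero : ∀ {k : ℝ → ℝ}, tsupport k ⊆ tsupport g → ∀ r ∉ Set.Ioi (0 : ℝ), k r = 0 :=
    fun hk r hr => image_eq_zero_of_notMem_tsupport fun h => hr (hgs (hk h))
  have h := setIntegral_smul_sphereMean_laplacian hg hgc hgs hf
  rwa [setIntegral_eq_integral_of_forall_compl_eq_zero fun r hr => by simp [hzero le_rfl r hr],
    setIntegral_eq_integral_of_forall_compl_eq_zero fun r hr => by
      simp [hzero tsupport_deriv_subset r hr]] at h

end SphericalMeans

/-- The time derivative of a function on space-time. -/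
local notation "∂ₜ" => dirDeriv ((1 : ℝ), 0)

/-- The derivative of a function on space-time in the spatial direction `v`. -/
local notation "∂ₓ[" v "]" => dirDeriv ((0 : ℝ), v)

section SpaceTime

variable {E F : Type*} [NormedAddCommGroup E] [NormedSpace ℝ E] [NormedAddCommGroup F]
  [NormedSpace ℝ F]

variable {u : ℝ × E → F}

theorem contDiff_timeSlice (hu : ContDiff ℝ ∞ u) (t : ℝ) : ContDiff ℝ ∞ (fun y => u (t, y)) :=
  hu.comp (contDiff_prodMk_right t)

theorem dirDeriv_timeSlice (hu : ContDiff ℝ ∞ u) (t : ℝ) (v : E) :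
    dirDeriv v (fun y => u (t, y)) = fun y => ∂ₓ[v] u (t, y) := by
  funext y
  simp [dirDeriv_comp hu (hasFDerivAt_prodMk_right t y)]

theorem hasDerivAt_timeDeriv (hu : ContDiff ℝ ∞ u) (t : ℝ) (y : E) :
    HasDerivAt (fun t => u (t, y)) (∂ₜ u (t, y)) t :=
  hasDerivAt_comp_curve hu ((hasDerivAt_id t).prodMk (hasDerivAt_const t y))

theorem spaceDeriv_eq_zero_of_slice (hu : ContDiff ℝ ∞ u) {t b : ℝ}
    (h : ∀ z, b < ‖z‖ → u (t, z) = 0) (v : E) {z : E} (hz : b < ‖z‖) :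
    ∂ₓ[v] u (t, z) = 0 := by
  have hzero : (fun y => u (t, y)) =ᶠ[𝓝 z] fun _ => 0 := by
    filter_upwards [(isOpen_lt continuous_const continuous_norm).mem_nhds hz] with y hy
    exact h y hy
  simpa [dirDeriv, hzero.fderiv_eq] using (congr_fun (dirDeriv_timeSlice hu t v) z).symm

end SpaceTime

section Waves

variable {E F : Type*} [NormedAddCommGroup E] [InnerProductSpace ℝ E] [FiniteDimensional ℝ E]
  [NormedAddCommGroup F] [NormedSpace ℝ F] {u v : ℝ × E → F}

/-- `u` is a smooth solution of the wave equation `(∂ₜ² - Δ) u = 0` on `ℝ × E`. -/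
structure IsSmoothWave (u : ℝ × E → F) : Prop where
  contDiff : ContDiff ℝ ∞ u
  wave_eq : ∀ t z, ∂ₜ (∂ₜ u) (t, z) = Laplacian.laplacian (fun y => u (t, y)) z

theorem laplacian_timeSlice {ι : Type*} [Fintype ι] (b : OrthonormalBasis ι ℝ E)
    (hu : ContDiff ℝ ∞ u) (t : ℝ) :
    Laplacian.laplacian (fun y => u (t, y)) =
      fun z => ∑ i, ∂ₓ[b i] (∂ₓ[b i] u) (t, z) := by
  rw [laplacian_eq_sum_dirDeriv b (contDiff_timeSlice hu t)]
  simp only [dirDeriv_timeSlice hu, dirDeriv_timeSlice (contDiff_dirDeriv hu _)]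

theorem isSmoothWave_iff_sum_spaceDeriv {ι : Type*} [Fintype ι] (b : OrthonormalBasis ι ℝ E) :
    IsSmoothWave u ↔ ContDiff ℝ ∞ u ∧
      ∂ₜ (∂ₜ u) = fun p => ∑ i, ∂ₓ[b i] (∂ₓ[b i] u) p := by
  refine ⟨fun h => ⟨h.contDiff, funext fun p => ?_⟩, fun h => ⟨h.1, fun t z => ?_⟩⟩
  · rw [h.wave_eq p.1 p.2, laplacian_timeSlice b h.contDiff]
  · rw [h.2, laplacian_timeSlice b h.1]

theorem IsSmoothWave.timeDeriv_timeDeriv {ι : Type*} [Fintype ι] (b : OrthonormalBasis ι ℝ E)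
    (hu : IsSmoothWave u) :
    ∂ₜ (∂ₜ u) = fun p => ∑ i, ∂ₓ[b i] (∂ₓ[b i] u) p :=
  ((isSmoothWave_iff_sum_spaceDeriv b).1 hu).2

theorem IsSmoothWave.sub (hu : IsSmoothWave u) (hv : IsSmoothWave v) :
    IsSmoothWave (fun p => u p - v p) := by
  set b := stdOrthonormalBasis ℝ E
  refine (isSmoothWave_iff_sum_spaceDeriv b).2 ⟨hu.contDiff.sub hv.contDiff, ?_⟩
  have hsub : ∀ w, dirDeriv w (dirDeriv w fun p => u p - v p) =
      fun p => dirDeriv w (dirDeriv w u) p - dirDeriv w (dirDeriv w v) p := fun w => by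
    rw [dirDeriv_sub hu.contDiff hv.contDiff,
      dirDeriv_sub (contDiff_dirDeriv hu.contDiff w) (contDiff_dirDeriv hv.contDiff w)]
  simp only [hsub, hu.timeDeriv_timeDeriv b, hv.timeDeriv_timeDeriv b, Finset.sum_sub_distrib]

theorem IsSmoothWave.timeDeriv (hu : IsSmoothWave u) : IsSmoothWave (∂ₜ u) := by
  set b := stdOrthonormalBasis ℝ E
  have hc : ∀ w, ContDiff ℝ ∞ (dirDeriv w u) := contDiff_dirDeriv hu.contDiff
  refine (isSmoothWave_iff_sum_spaceDeriv b).2 ⟨hc _, ?_⟩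
  rw [hu.timeDeriv_timeDeriv b, dirDeriv_sum _ fun i => contDiff_dirDeriv (hc _) _]
  funext p
  refine Finset.sum_congr rfl fun i _ => ?_
  rw [dirDeriv_comm (hc _), dirDeriv_comm hu.contDiff]

/-- The reflection `(t, z) ↦ (-t, z)` of space-time. -/
def timeReflection (E : Type*) [NormedAddCommGroup E] [NormedSpace ℝ E] : ℝ × E →L[ℝ] ℝ × E :=
  (-ContinuousLinearMap.fst ℝ ℝ E).prod (ContinuousLinearMap.snd ℝ ℝ E)

omit [FiniteDimensional ℝ E] in
@[simp]
theorem timeReflection_apply (p : ℝ × E) : timeReflection E p = (-p.1, p.2) := rfl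

omit [FiniteDimensional ℝ E] in
theorem dirDeriv_comp_timeReflection (hu : ContDiff ℝ ∞ u) (w : ℝ × E) :
    dirDeriv w (fun p => u (timeReflection E p)) =
      fun p => dirDeriv (timeReflection E w) u (timeReflection E p) :=
  funext fun _ => dirDeriv_comp hu (timeReflection E).hasFDerivAt w

omit [FiniteDimensional ℝ E] in
theorem timeDeriv_comp_timeReflection (hu : ContDiff ℝ ∞ u) (p : ℝ × E) :
    ∂ₜ (fun p => u (timeReflection E p)) p = - ∂ₜ u (timeReflection E p) := by
  have hneg : timeReflection E (1, 0) = -(1, 0) := by simp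
  rw [dirDeriv_comp_timeReflection hu, hneg, dirDeriv_neg_left]

theorem IsSmoothWave.comp_timeReflection (hu : IsSmoothWave u) :
    IsSmoothWave (fun p => u (timeReflection E p)) := by
  refine ⟨hu.contDiff.comp (timeReflection E).contDiff, fun t z => ?_⟩
  have hneg : timeReflection E (1, 0) = -(1, 0) := by simp
  change dirDeriv _ (dirDeriv _ fun p => u (timeReflection E p)) _ =
    Laplacian.laplacian (fun y => u (-t, y)) z
  rw [← hu.wave_eq, dirDeriv_comp_timeReflection hu.contDiff,
    dirDeriv_comp_timeReflection (contDiff_dirDeriv hu.contDiff _), hneg]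
  beta_reduce
  rw [dirDeriv_dirDeriv hu.contDiff, dirDeriv_dirDeriv hu.contDiff, map_neg, map_neg, neg_apply,
    neg_neg, timeReflection_apply]

end Waves

section Kirchhoff

variable {E F : Type*} [NormedAddCommGroup E] [InnerProductSpace ℝ E] [FiniteDimensional ℝ E]
  [MeasurableSpace E] [BorelSpace E] [NormedAddCommGroup F] [NormedSpace ℝ F] {u : ℝ × E → F}

/-- The integrals of a function on space-time over the spheres around the point `z`, as a function
of time and radius. -/
noncomputable def timeSphereMean (u : ℝ × E → F) (z : E) (p : ℝ × ℝ) : F :=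
  sphereMean (fun y => u (p.1, z + y)) p.2

theorem contDiff_timeSphereMean (hu : ContDiff ℝ ∞ u) (z : E) :
    ContDiff ℝ ∞ (timeSphereMean u z) :=
  contDiff_sphere_integral (f := fun q : (ℝ × ℝ) × E => u (q.1.1, z + q.1.2 • q.2))
    (hu.comp (by fun_prop))

theorem timeDeriv_timeSphereMean (hu : ContDiff ℝ ∞ u) (z : E) :
    ∂ₜ (timeSphereMean u z) = timeSphereMean (∂ₜ u) z := by
  set f : (ℝ × ℝ) × E → F := fun q => u (q.1.1, z + q.1.2 • q.2)
  have hf : ContDiff ℝ ∞ f := hu.comp (by fun_prop)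
  refine (dirDeriv_sphere_integral (μ := volume) hf (1, 0)).trans (funext fun p => ?_)
  refine integral_congr_ae (Eventually.of_forall fun θ => ?_)
  have hcurve := hasDerivAt_comp_curve hf (γ := fun t => ((t, p.2), (θ : E)))
    (((hasDerivAt_id p.1).prodMk (hasDerivAt_const _ _)).prodMk (hasDerivAt_const _ _))
  exact hcurve.unique (hasDerivAt_timeDeriv hu p.1 (z + p.2 • (θ : E)))

theorem spaceDeriv_timeSphereMean (hu : ContDiff ℝ ∞ u) (z : E) (t r : ℝ) :
    ∂ₓ[1] (timeSphereMean u z) (t, r) = deriv (sphereMean fun y => u (t, z + y)) r :=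
  (congr_fun (dirDeriv_timeSlice (contDiff_timeSphereMean hu z) t 1) r).symm

/-- The Euler–Poisson–Darboux equation in dimension three says that `r m` solves the wave equation
in one dimension, so that `(∂ₜ + ∂ᵣ) (r m)` is constant on the lines `t + r = c`. -/
theorem darboux_characteristic {m : ℝ × ℝ → F} (hm : ContDiff ℝ ∞ m)
    (h : ∀ t r : ℝ, 0 < r → (2 : ℝ) • ∂ₓ[1] m (t, r) +
      r • ∂ₓ[1] (∂ₓ[1] m) (t, r) = r • ∂ₜ (∂ₜ m) (t, r))
    (c : ℝ) {r : ℝ} (hr : 0 ≤ r) :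
    r • ∂ₜ m (c - r, r) + m (c - r, r) + r • ∂ₓ[1] m (c - r, r) = m (c, 0) := by
  have hmt := contDiff_dirDeriv hm (1, 0)
  have hmr := contDiff_dirDeriv hm (0, 1)
  have hline : ∀ s : ℝ, HasDerivAt (fun s : ℝ => (c - s, s)) ((-1 : ℝ), (1 : ℝ)) s := fun s =>
    ((hasDerivAt_id s).const_sub c).prodMk (hasDerivAt_id s)
  have hsplit : ∀ (f : ℝ × ℝ → F) (p : ℝ × ℝ),
      dirDeriv (-1, 1) f p = -∂ₜ f p + ∂ₓ[1] f p := fun f p => by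
    have : ((-1 : ℝ), (1 : ℝ)) = -(1, 0) + (0, 1) := by simp
    simp only [dirDeriv]
    rw [this, map_add, map_neg]
  have hd : ∀ s : ℝ, HasDerivAt (fun s : ℝ => s • ∂ₜ m (c - s, s) + m (c - s, s) +
      s • ∂ₓ[1] m (c - s, s)) ((2 : ℝ) • ∂ₓ[1] m (c - s, s) +
        s • ∂ₓ[1] (∂ₓ[1] m) (c - s, s) -
        s • ∂ₜ (∂ₜ m) (c - s, s)) s := by
    intro s
    have d := (((hasDerivAt_id s).fun_smul (hasDerivAt_comp_curve hmt (hline s))).add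
      (hasDerivAt_comp_curve hm (hline s))).add
      ((hasDerivAt_id s).fun_smul (hasDerivAt_comp_curve hmr (hline s)))
    refine d.congr_deriv ?_
    rw [hsplit, hsplit, hsplit, dirDeriv_comm hm (0, 1) (1, 0)]
    simp only [id_eq]
    module
  have hzero : ∀ s ∈ Set.Ico 0 r, (2 : ℝ) • ∂ₓ[1] m (c - s, s) +
      s • ∂ₓ[1] (∂ₓ[1] m) (c - s, s) - s • ∂ₜ (∂ₜ m) (c - s, s) = 0 := by
    intro s hs
    have heq : Set.EqOn (fun r => (2 : ℝ) • ∂ₓ[1] m (c - s, r) + r • ∂ₓ[1] (∂ₓ[1] m) (c - s, r) -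
        r • ∂ₜ (∂ₜ m) (c - s, r)) 0 (Set.Ioi 0) := fun r hr => sub_eq_zero.2 (h (c - s) r hr)
    have := hmr.continuous
    have := (contDiff_dirDeriv hmr (0, 1)).continuous
    have := (contDiff_dirDeriv hmt (1, 0)).continuous
    exact heq.closure (by fun_prop) continuous_const (closure_Ioi (0 : ℝ) ▸ hs.1)
  have hconst := constant_of_has_deriv_right_zero (a := 0) (b := r)
    (fun s _ => (hd s).continuousAt.continuousWithinAt)
    (fun s hs => hzero s hs ▸ (hd s).hasDerivWithinAt) r ⟨hr, le_rfl⟩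
  simpa using hconst

theorem IsSmoothWave.darboux [Nontrivial E] [CompleteSpace F] (hu : IsSmoothWave u) (z : E)
    (t : ℝ) {r : ℝ} (hr : 0 < r) :
    ((Module.finrank ℝ E - 1 : ℕ) : ℝ) • ∂ₓ[1] (timeSphereMean u z) (t, r) +
      r • ∂ₓ[1] (∂ₓ[1] (timeSphereMean u z)) (t, r) =
        r • ∂ₜ (∂ₜ (timeSphereMean u z)) (t, r) := by
  have hf : ContDiff ℝ ∞ fun y => u (t, z + y) := hu.contDiff.comp (by fun_prop)
  have hm := contDiff_timeSphereMean hu.contDiff z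
  have htt : ∂ₜ (∂ₜ (timeSphereMean u z)) (t, r) =
      sphereMean (Laplacian.laplacian fun y => u (t, z + y)) r := by
    rw [timeDeriv_timeSphereMean hu.contDiff,
      timeDeriv_timeSphereMean (contDiff_dirDeriv hu.contDiff _)]
    simp only [timeSphereMean, hu.wave_eq, laplacian_translate (contDiff_timeSlice hu.contDiff t)]
  have hrr : HasDerivAt (deriv (sphereMean fun y => u (t, z + y)))
      (∂ₓ[1] (∂ₓ[1] (timeSphereMean u z)) (t, r)) r := by
    have h := hasDerivAt_comp_curve (contDiff_dirDeriv hm (0, 1))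
      ((hasDerivAt_const r t).prodMk (hasDerivAt_id r))
    simpa only [spaceDeriv_timeSphereMean hu.contDiff, id_eq] using h
  have hepd := euler_poisson_darboux hf hr
  rw [((hasDerivAt_pow _ r).fun_smul hrr).deriv, ← htt,
    ← spaceDeriv_timeSphereMean hu.contDiff] at hepd
  have hpow : r * (((Module.finrank ℝ E - 1 : ℕ) : ℝ) * r ^ (Module.finrank ℝ E - 1 - 1)) =
      (Module.finrank ℝ E - 1 : ℕ) * r ^ (Module.finrank ℝ E - 1) := by
    rcases Nat.eq_zero_or_pos (Module.finrank ℝ E - 1) with h0 | h0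
    · simp [h0]
    · rw [mul_left_comm, mul_pow_sub_one h0.ne']
  apply smul_right_injective F (pow_pos hr (Module.finrank ℝ E - 1)).ne'
  dsimp only
  rw [smul_comm _ r, ← hepd, smul_add, smul_add, smul_smul, smul_smul, smul_smul, smul_smul, hpow]
  module

section ThreeDimensional

variable [CompleteSpace F] [hdim : Fact (Module.finrank ℝ E = 3)]
include hdim

theorem IsSmoothWave.sphereMean_characteristic (hu : IsSmoothWave u) (z : E) (c : ℝ) {r : ℝ}
    (hr : 0 ≤ r) :
    r • ∂ₜ (timeSphereMean u z) (c - r, r) + timeSphereMean u z (c - r, r) +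
      r • ∂ₓ[1] (timeSphereMean u z) (c - r, r) = (surfaceMeasure E).real Set.univ • u (c, z) := by
  have : Nontrivial E := Module.nontrivial_of_finrank_pos (R := ℝ) (by simp [hdim.out])
  rw [darboux_characteristic (contDiff_timeSphereMean hu.contDiff z) (fun t r hr => ?_) c hr]
  · simp [timeSphereMean, sphereMean]
  · simpa [hdim.out] using hu.darboux z t hr

theorem IsSmoothWave.kirchhoff (hu : IsSmoothWave u) {t : ℝ} (ht : 0 ≤ t) (z : E) :
    (surfaceMeasure E).real Set.univ • u (t, z) =
      t • ∫ θ : Metric.sphere (0 : E) 1, ∂ₜ u (0, z + t • (θ : E)) ∂surfaceMeasure E +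
      ∫ θ : Metric.sphere (0 : E) 1, u (0, z + t • (θ : E)) ∂surfaceMeasure E +
      t • ∫ θ : Metric.sphere (0 : E) 1, ∂ₓ[(θ : E)] u (0, z + t • (θ : E)) ∂surfaceMeasure E := by
  have hf : ContDiff ℝ ∞ fun y => u (0, z + y) := hu.contDiff.comp (by fun_prop)
  have h := hu.sphereMean_characteristic z t ht
  rw [sub_self, timeDeriv_timeSphereMean hu.contDiff, spaceDeriv_timeSphereMean hu.contDiff,
    deriv_sphereMean hf] at h
  have hslice : ∀ v y : E, fderiv ℝ (fun y => u (0, z + y)) y v = ∂ₓ[v] u (0, z + y) := fun v y =>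
    (congr_fun (dirDeriv_translate (fun y => u (0, y)) z v) y).trans
      (congr_fun (dirDeriv_timeSlice hu.contDiff 0 v) (z + y))
  simp only [hslice] at h
  exact h.symm

end ThreeDimensional

end Kirchhoff

section Decay

variable {E F : Type*} [NormedAddCommGroup E] [NormedSpace ℝ E] [NormedAddCommGroup F]
  [NormedSpace ℝ F] [CompleteSpace F] {χ : E → F}

theorem enorm_le_lintegral_fderiv_ray (hχ : ContDiff ℝ 1 χ) (hc : HasCompactSupport χ) (z : E)
    (θ : Metric.sphere (0 : E) 1) (T : ℝ) :
    ‖χ (z + T • (θ : E))‖ₑ ≤ ∫⁻ r in Set.Ioi T, ‖fderiv ℝ χ (z + r • (θ : E))‖ₑ := by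
  have hray : Isometry fun r : ℝ => z + r • (θ : E) := Isometry.of_dist_eq fun r s => by
    simp [dist_eq_norm, ← sub_smul, norm_smul]
  have hderiv : ∀ r, HasDerivAt (fun r : ℝ => χ (z + r • (θ : E)))
      (fderiv ℝ χ (z + r • (θ : E)) θ) r := fun r =>
    (hχ.differentiable one_ne_zero _).hasFDerivAt.comp_hasDerivAt r
      (by simpa using ((hasDerivAt_id r).smul_const (θ : E)).const_add z)
  have hftc := HasCompactSupport.integral_Ioi_deriv_eq
    (f := fun r : ℝ => χ (z + r • (θ : E))) (hχ.comp (by fun_prop))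
    (hc.comp_isClosedEmbedding hray.isClosedEmbedding) T
  rw [← enorm_neg, ← hftc]
  refine (enorm_integral_le_lintegral_enorm _).trans (lintegral_mono fun r => ?_)
  rw [(hderiv r).deriv]
  simpa [← ofReal_norm] using
    ENNReal.ofReal_le_ofReal ((fderiv ℝ χ (z + r • (θ : E))).le_opNorm θ)

variable [FiniteDimensional ℝ E] [MeasurableSpace E] [BorelSpace E] [Nontrivial E]
  {μ : Measure E} [μ.IsAddHaarMeasure]

theorem integral_norm_sphere_le (hχ : ContDiff ℝ 1 χ) (hc : HasCompactSupport χ) (z : E) {T : ℝ}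
    (hT : 0 < T) :
    ∫ θ : Metric.sphere (0 : E) 1, ‖χ (z + T • (θ : E))‖ ∂μ.toSphere ≤
      (∫ y, ‖fderiv ℝ χ y‖ ∂μ) / T ^ (Module.finrank ℝ E - 1) := by
  have hD := hχ.continuous_fderiv one_ne_zero
  have hfin : ∫⁻ y, ‖fderiv ℝ χ y‖ₑ ∂μ ≠ ⊤ :=
    (hD.integrable_of_hasCompactSupport (μ := μ) (hc.fderiv (𝕜 := ℝ))).2.ne
  have hle : ∫⁻ θ : Metric.sphere (0 : E) 1, ‖χ (z + T • (θ : E))‖ₑ ∂μ.toSphere ≤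
      ENNReal.ofReal ((T ^ (Module.finrank ℝ E - 1))⁻¹) * ∫⁻ y, ‖fderiv ℝ χ y‖ₑ ∂μ := by
    rw [← lintegral_add_left_eq_self (μ := μ) _ z, lintegral_eq_lintegral_sphere μ (by fun_prop),
      ← lintegral_const_mul' _ _ ENNReal.ofReal_ne_top]
    refine lintegral_mono fun θ => (enorm_le_lintegral_fderiv_ray hχ hc z θ T).trans ?_
    rw [← lintegral_const_mul' _ _ ENNReal.ofReal_ne_top]
    refine (setLIntegral_mono' measurableSet_Ioi fun r (hr : T < r) => ?_).trans
      (lintegral_mono_set (Set.Ioi_subset_Ioi hT.le))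
    rw [← mul_assoc, ← ENNReal.ofReal_mul (by positivity)]
    refine le_mul_of_one_le_left' (ENNReal.one_le_ofReal.2 ?_)
    rw [inv_mul_eq_div, one_le_div (by positivity)]
    gcongr
  have hc0 := hχ.continuous
  rw [integral_norm_eq_lintegral_enorm (Continuous.aestronglyMeasurable (by fun_prop)),
    integral_norm_eq_lintegral_enorm hD.aestronglyMeasurable]
  refine (ENNReal.toReal_mono (ENNReal.mul_ne_top ENNReal.ofReal_ne_top hfin) hle).trans ?_
  rw [ENNReal.toReal_mul, ENNReal.toReal_ofReal (by positivity), inv_mul_eq_div]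

end Decay

theorem hasCompactSupport_of_eq_zero {E F : Type*} [NormedAddCommGroup E] [ProperSpace E] [Zero F]
    {f : E → F} {a : ℝ} (h : ∀ z, a < ‖z‖ → f z = 0) : HasCompactSupport f :=
  HasCompactSupport.of_support_subset_isCompact (isCompact_closedBall (0 : E) a) fun z hz => by
    by_contra ha
    exact hz (h z (by simpa using ha))

section Huygens

variable {E F : Type*} [NormedAddCommGroup E] [InnerProductSpace ℝ E] [FiniteDimensional ℝ E]
  [NormedAddCommGroup F] [NormedSpace ℝ F] {u : ℝ × E → F} {a : ℝ}

/-- The Cauchy data of `u` at time `0` vanish outside the ball of radius `a`. -/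
def DataSupportedIn (a : ℝ) (u : ℝ × E → F) : Prop :=
  ∀ z, a < ‖z‖ → u (0, z) = 0 ∧ ∂ₜ u (0, z) = 0

theorem DataSupportedIn.timeDeriv (h : DataSupportedIn a u) (hu : IsSmoothWave u) :
    DataSupportedIn a (∂ₜ u) := fun z hz => by
  refine ⟨(h z hz).2, ?_⟩
  rw [hu.timeDeriv_timeDeriv (stdOrthonormalBasis ℝ E)]
  refine Finset.sum_eq_zero fun i _ =>
    spaceDeriv_eq_zero_of_slice (contDiff_dirDeriv hu.contDiff _) (fun y hy => ?_) _ hz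
  exact spaceDeriv_eq_zero_of_slice hu.contDiff (fun x hx => (h x hx).1) _ hy

omit [FiniteDimensional ℝ E] in
theorem DataSupportedIn.comp_timeReflection (h : DataSupportedIn a u) (hu : ContDiff ℝ ∞ u) :
    DataSupportedIn a (fun p => u (timeReflection E p)) := fun z hz => by
  rw [timeDeriv_comp_timeReflection hu]
  simp [(h z hz).1, (h z hz).2]

variable [MeasurableSpace E] [BorelSpace E]

variable (E) in
theorem surfaceMeasure_real_univ_pos [Nontrivial E] : 0 < (surfaceMeasure E).real Set.univ :=
  ENNReal.toReal_pos (Measure.measure_univ_eq_zero.not.2 (Measure.toSphere_ne_zero volume))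
    (measure_ne_top _ _)

variable [CompleteSpace F] [hdim : Fact (Module.finrank ℝ E = 3)]
include hdim

theorem IsSmoothWave.huygens_of_nonneg (hu : IsSmoothWave u) (h : DataSupportedIn a u)
    {t : ℝ} (ht : 0 ≤ t) {z : E} (hz : t + a < ‖z‖ ∨ ‖z‖ < t - a) : u (t, z) = 0 := by
  have : Nontrivial E := Module.nontrivial_of_finrank_pos (R := ℝ) (by simp [hdim.out])
  have hfar : ∀ θ : Metric.sphere (0 : E) 1, a < ‖z + t • (θ : E)‖ := fun θ => by
    have h1 := norm_sub_le (z + t • (θ : E)) (t • (θ : E))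
    have h2 := norm_sub_le (z + t • (θ : E)) z
    simp only [add_sub_cancel_right, add_sub_cancel_left, norm_smul_sphere ht] at h1 h2
    rcases hz with hz | hz <;> linarith
  have hk := hu.kirchhoff ht z
  have hslice : ∀ θ : Metric.sphere (0 : E) 1, ∂ₓ[(θ : E)] u (0, z + t • (θ : E)) = 0 := fun θ =>
    spaceDeriv_eq_zero_of_slice hu.contDiff (fun x hx => (h x hx).1) _ (hfar θ)
  simp only [(h _ (hfar _)).1, (h _ (hfar _)).2, hslice, integral_zero, smul_zero, add_zero] at hk
  exact (smul_eq_zero.1 hk).resolve_left (surfaceMeasure_real_univ_pos E).ne'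

theorem IsSmoothWave.huygens (hu : IsSmoothWave u) (h : DataSupportedIn a u)
    {t : ℝ} {z : E} (hz : |t| + a < ‖z‖ ∨ ‖z‖ < |t| - a) : u (t, z) = 0 := by
  rcases le_total 0 t with ht | ht
  · rw [abs_of_nonneg ht] at hz
    exact hu.huygens_of_nonneg h ht hz
  · rw [abs_of_nonpos ht] at hz
    simpa using hu.comp_timeReflection.huygens_of_nonneg
      (h.comp_timeReflection hu.contDiff) (neg_nonneg.2 ht) hz

theorem IsSmoothWave.norm_mul_le (hu : IsSmoothWave u) (h : DataSupportedIn a u) {t : ℝ}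
    (ht : 0 < t) (z : E) :
    (surfaceMeasure E).real Set.univ * ‖u (t, z)‖ ≤
      t * ((∫ y, ‖fderiv ℝ (fun y => ∂ₜ u (0, y)) y‖) / t ^ 2) +
        (∫ y, ‖fderiv ℝ (fun y => u (0, y)) y‖) / t ^ 2 +
        t * ((∫ y, ‖fderiv ℝ (fderiv ℝ fun y => u (0, y)) y‖) / t ^ 2) := by
  have : Nontrivial E := Module.nontrivial_of_finrank_pos (R := ℝ) (by simp [hdim.out])
  have hpow : Module.finrank ℝ E - 1 = 2 := by simp [hdim.out]
  have hone : (1 : WithTop ℕ∞) ≤ ∞ := by exact_mod_cast le_top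
  have hφ : ContDiff ℝ ∞ fun y => u (0, y) := contDiff_timeSlice hu.contDiff 0
  have hφ' : ContDiff ℝ ∞ (fderiv ℝ fun y => u (0, y)) := hφ.fderiv_right (m := ∞) (by simp)
  have hψ : ContDiff ℝ ∞ fun y => ∂ₜ u (0, y) :=
    contDiff_timeSlice (contDiff_dirDeriv hu.contDiff _) 0
  have hφc : HasCompactSupport fun y => u (0, y) :=
    hasCompactSupport_of_eq_zero fun z hz => (h z hz).1
  have hψc : HasCompactSupport fun y => ∂ₜ u (0, y) :=
    hasCompactSupport_of_eq_zero fun z hz => (h z hz).2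
  have hslice : ∀ θ : Metric.sphere (0 : E) 1, ‖∂ₓ[(θ : E)] u (0, z + t • (θ : E))‖ ≤
      ‖fderiv ℝ (fun y => u (0, y)) (z + t • (θ : E))‖ := fun θ => by
    rw [← congr_fun (dirDeriv_timeSlice hu.contDiff 0 (θ : E)) (z + t • (θ : E))]
    simpa [dirDeriv] using (fderiv ℝ (fun y => u (0, y)) (z + t • (θ : E))).le_opNorm θ
  have hcont := hφ'.continuous
  have hnorm := (congr_arg norm (hu.kirchhoff ht.le z)).trans_le norm_add₃_le
  rw [norm_smul, norm_smul, norm_smul, Real.norm_of_nonneg measureReal_nonneg,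
    Real.norm_of_nonneg ht.le] at hnorm
  refine hnorm.trans ?_
  rw [← hpow]
  gcongr
  · exact (norm_integral_le_integral_norm _).trans
      (integral_norm_sphere_le (hψ.of_le hone) hψc z ht)
  · exact (norm_integral_le_integral_norm _).trans
      (integral_norm_sphere_le (hφ.of_le hone) hφc z ht)
  · exact (norm_integral_le_of_norm_le (integrable_sphere_of_continuous (by fun_prop))
      (Eventually.of_forall hslice)).trans
      (integral_norm_sphere_le (hφ'.of_le hone) (hφc.fderiv (𝕜 := ℝ)) z ht)

theorem IsSmoothWave.exists_decay (hu : IsSmoothWave u) (h : DataSupportedIn a u) :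
    ∃ C : ℝ, ∀ (t : ℝ) (z : E), 1 ≤ t → ‖u (t, z)‖ ≤ C / t := by
  have : Nontrivial E := Module.nontrivial_of_finrank_pos (R := ℝ) (by simp [hdim.out])
  have hκ := surfaceMeasure_real_univ_pos E
  set I₁ := ∫ y, ‖fderiv ℝ (fun y => ∂ₜ u (0, y)) y‖
  set I₀ := ∫ y, ‖fderiv ℝ (fun y => u (0, y)) y‖
  set I₂ := ∫ y, ‖fderiv ℝ (fderiv ℝ fun y => u (0, y)) y‖
  have hI₀_nonneg : 0 ≤ I₀ := integral_nonneg fun _ => norm_nonneg _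
  refine ⟨(I₁ + I₀ + I₂) / (surfaceMeasure E).real Set.univ, fun t z ht => ?_⟩
  have ht0 : 0 < t := one_pos.trans_le ht
  rw [div_right_comm, le_div_iff₀' hκ]
  calc (surfaceMeasure E).real Set.univ * ‖u (t, z)‖
      ≤ t * (I₁ / t ^ 2) + I₀ / t ^ 2 + t * (I₂ / t ^ 2) := hu.norm_mul_le h ht0 z
    _ = (I₁ + I₂) / t + I₀ / t ^ 2 := by field_simp; ring
    _ ≤ (I₁ + I₂) / t + I₀ / t :=
      add_le_add_right (div_le_div_of_nonneg_left hI₀_nonneg ht0 (le_self_pow₀ ht two_ne_zero)) _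
    _ = (I₁ + I₀ + I₂) / t := by ring

end Huygens

section Energy

variable {E F : Type*} [NormedAddCommGroup E] [NormedSpace ℝ E] [NormedAddCommGroup F] {a : ℝ}

/-- `f` vanishes outside the light cone over the ball of radius `a`. -/
def ConeSupported (a : ℝ) (f : ℝ × E → F) : Prop :=
  ∀ t z, |t| + a < ‖z‖ → f (t, z) = 0

protected theorem ConeSupported.dirDeriv [NormedSpace ℝ F] {f : ℝ × E → F} (h : ConeSupported a f)
    (w : ℝ × E) : ConeSupported a (dirDeriv w f) := fun t z hz => by
  have hzero : f =ᶠ[𝓝 (t, z)] fun _ => 0 := by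
    have ho : IsOpen {p : ℝ × E | |p.1| + a < ‖p.2‖} := isOpen_lt (by fun_prop) (by fun_prop)
    filter_upwards [ho.mem_nhds hz] with p hp
    exact h p.1 p.2 hp
  simp [dirDeriv, hzero.fderiv_eq]

omit [NormedSpace ℝ E] in
theorem ConeSupported.inner_right [InnerProductSpace ℝ F] {f : ℝ × E → F} (h : ConeSupported a f)
    (g : ℝ × E → F) : ConeSupported a (fun p => inner ℝ (f p) (g p)) := fun t z hz => by
  simp [h t z hz]

variable [FiniteDimensional ℝ E]

theorem ConeSupported.hasCompactSupport {f : ℝ × E → F} (h : ConeSupported a f) (t : ℝ) :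
    HasCompactSupport (fun z => f (t, z)) :=
  have := FiniteDimensional.proper_real E
  hasCompactSupport_of_eq_zero fun z hz => h t z hz

variable [MeasurableSpace E] [BorelSpace E] {μ : Measure E} [μ.IsAddHaarMeasure]

theorem ConeSupported.integrable {f : ℝ × E → F} (h : ConeSupported a f) (hf : Continuous f)
    (t : ℝ) : Integrable (fun z => f (t, z)) μ :=
  (hf.comp (by fun_prop)).integrable_of_hasCompactSupport (h.hasCompactSupport t)

theorem ConeSupported.hasDerivAt_integral [NormedSpace ℝ F] {f : ℝ × E → F}
    (h : ConeSupported a f) (hf : ContDiff ℝ ∞ f) (t : ℝ) :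
    HasDerivAt (fun t => ∫ z, f (t, z) ∂μ) (∫ z, ∂ₜ f (t, z) ∂μ) t := by
  have hf' := (contDiff_dirDeriv hf (1, 0)).continuous
  have := FiniteDimensional.proper_real E
  obtain ⟨M, hM⟩ := ((isCompact_closedBall t 1).prod
    (isCompact_closedBall (0 : E) (|t| + 1 + a))).bddAbove_image hf'.norm.continuousOn
  refine (hasDerivAt_integral_of_dominated_loc_of_deriv_le (s := Metric.closedBall t 1)
    (bound := (Metric.closedBall (0 : E) (|t| + 1 + a)).indicator fun _ => M)
    (F' := fun t z => ∂ₜ f (t, z)) (Metric.closedBall_mem_nhds t one_pos)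
    (Eventually.of_forall fun s => (h.integrable hf.continuous s).aestronglyMeasurable)
    (h.integrable hf.continuous t) ((h.dirDeriv _).integrable hf' t).aestronglyMeasurable
    ?_ ?_ (Eventually.of_forall fun z s _ => hasDerivAt_timeDeriv hf s z)).2
  · refine Eventually.of_forall fun z s hs => ?_
    by_cases hz : z ∈ Metric.closedBall (0 : E) (|t| + 1 + a)
    · rw [Set.indicator_of_mem hz]
      exact hM ⟨(s, z), ⟨hs, hz⟩, rfl⟩
    · have hst : |s - t| ≤ 1 := by simpa [Real.dist_eq] using hs
      have hza : |t| + 1 + a < ‖z‖ := by simpa using hz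
      rw [Set.indicator_of_notMem hz, h.dirDeriv (1, 0) s z, norm_zero]
      linarith [abs_sub_abs_le_abs_sub s t]
  · exact (integrable_indicator_iff Metric.isClosed_closedBall.measurableSet).2
      (integrableOn_const (isCompact_closedBall _ _).measure_lt_top.ne)

variable [InnerProductSpace ℝ F] {f g : ℝ × E → F}

theorem ConeSupported.hasDerivAt_integral_inner (h : ConeSupported a f) (hf : ContDiff ℝ ∞ f)
    (hg : ContDiff ℝ ∞ g) (t : ℝ) :
    HasDerivAt (fun t => ∫ z, inner ℝ (f (t, z)) (g (t, z)) ∂μ)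
      (∫ z, inner ℝ (f (t, z)) (∂ₜ g (t, z)) ∂μ + ∫ z, inner ℝ (∂ₜ f (t, z)) (g (t, z)) ∂μ) t := by
  refine ((h.inner_right g).hasDerivAt_integral (hf.inner ℝ hg) t).congr_deriv ?_
  rw [← integral_add]
  · exact integral_congr_ae (Eventually.of_forall fun z => fderiv_inner_apply ℝ
      (hf.differentiable (by simp) _) (hg.differentiable (by simp) _) _)
  · exact (h.inner_right _).integrable
      (hf.inner ℝ (contDiff_dirDeriv hg _)).continuous t
  · exact ((h.dirDeriv _).inner_right _).integrable
      ((contDiff_dirDeriv hf _).inner ℝ hg).continuous t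

theorem ConeSupported.hasDerivAt_integral_norm_sq (h : ConeSupported a f) (hf : ContDiff ℝ ∞ f)
    (t : ℝ) :
    HasDerivAt (fun t => ∫ z, ‖f (t, z)‖ ^ 2 ∂μ)
      (2 * ∫ z, inner ℝ (f (t, z)) (∂ₜ f (t, z)) ∂μ) t := by
  have hd := h.hasDerivAt_integral_inner (μ := μ) hf hf t
  simp only [real_inner_self_eq_norm_sq, real_inner_comm (f _) (∂ₜ f _)] at hd
  rwa [two_mul]

theorem ConeSupported.integral_inner_spaceDeriv (h : ConeSupported a f) (hf : ContDiff ℝ ∞ f)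
    (hg : ContDiff ℝ ∞ g) (t : ℝ) (w : E) :
    ∫ z, inner ℝ (f (t, z)) (∂ₓ[w] g (t, z)) ∂μ =
      -∫ z, inner ℝ (∂ₓ[w] f (t, z)) (g (t, z)) ∂μ := by
  have hparts := integral_bilin_dirDeriv (μ := μ) (innerSL ℝ) (contDiff_timeSlice hf t)
    (contDiff_timeSlice hg t) (h.hasCompactSupport t) w
  rw [dirDeriv_timeSlice hf, dirDeriv_timeSlice hg] at hparts
  exact hparts

end Energy

section WaveEnergy

variable {E F ι : Type*} [NormedAddCommGroup E] [InnerProductSpace ℝ E] [FiniteDimensional ℝ E]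
  [MeasurableSpace E] [BorelSpace E] [NormedAddCommGroup F] [InnerProductSpace ℝ F] [Fintype ι]
  {a : ℝ} {u f : ℝ × E → F}

theorem IsSmoothWave.coneSupported [CompleteSpace F] [Fact (Module.finrank ℝ E = 3)]
    (hu : IsSmoothWave u) (h : DataSupportedIn a u) : ConeSupported a u :=
  fun _ _ hz => hu.huygens h (Or.inl hz)

theorem IsSmoothWave.integral_inner_timeDeriv_timeDeriv (hu : IsSmoothWave u)
    (b : OrthonormalBasis ι ℝ E) (h : ConeSupported a f) (hf : ContDiff ℝ ∞ f) (t : ℝ) :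
    ∫ z, inner ℝ (f (t, z)) (∂ₜ (∂ₜ u) (t, z)) =
      -∑ i, ∫ z, inner ℝ (∂ₓ[b i] f (t, z)) (∂ₓ[b i] u (t, z)) := by
  have hc := fun i => contDiff_dirDeriv hu.contDiff (0, b i)
  simp only [hu.timeDeriv_timeDeriv b, inner_sum]
  rw [integral_finsetSum, ← Finset.sum_neg_distrib]
  · exact Finset.sum_congr rfl fun i _ => h.integral_inner_spaceDeriv hf (hc i) t _
  · exact fun i _ => (h.inner_right _).integrable
      (hf.inner ℝ (contDiff_dirDeriv (hc i) _)).continuous t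

/-- Twice the kinetic energy of `u` at time `t`. -/
noncomputable def kineticEnergy (u : ℝ × E → F) (t : ℝ) : ℝ :=
  ∫ z, ‖∂ₜ u (t, z)‖ ^ 2

/-- Twice the potential energy of `u` at time `t`; it does not depend on the orthonormal basis. -/
noncomputable def potentialEnergy (b : OrthonormalBasis ι ℝ E) (u : ℝ × E → F) (t : ℝ) : ℝ :=
  ∑ i, ∫ z, ‖∂ₓ[b i] u (t, z)‖ ^ 2

theorem IsSmoothWave.hasDerivAt_energy (hu : IsSmoothWave u) (b : OrthonormalBasis ι ℝ E)
    (h : ConeSupported a u) (t : ℝ) :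
    HasDerivAt (fun t => kineticEnergy u t + potentialEnergy b u t) 0 t := by
  have hc := contDiff_dirDeriv hu.contDiff
  have hK := (h.dirDeriv (1, 0)).hasDerivAt_integral_norm_sq (μ := volume) (hc _) t
  have hP := fun i =>
    (h.dirDeriv (0, b i)).hasDerivAt_integral_norm_sq (μ := volume) (hc _) t
  refine (hK.add (HasDerivAt.fun_sum fun i _ => hP i)).congr_deriv ?_
  rw [hu.integral_inner_timeDeriv_timeDeriv b (h.dirDeriv _) (hc _), ← Finset.mul_sum, ← mul_add,
    ← sub_eq_neg_add, ← Finset.sum_sub_distrib, mul_eq_zero]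
  refine Or.inr (Finset.sum_eq_zero fun i _ => ?_)
  simp only [dirDeriv_comm hu.contDiff (1, 0), real_inner_comm, sub_self]

theorem IsSmoothWave.energy_conservation (hu : IsSmoothWave u) (b : OrthonormalBasis ι ℝ E)
    (h : ConeSupported a u) (t : ℝ) :
    kineticEnergy u t + potentialEnergy b u t = kineticEnergy u 0 + potentialEnergy b u 0 :=
  is_const_of_deriv_eq_zero (fun t => (hu.hasDerivAt_energy b h t).differentiableAt)
    (fun t => (hu.hasDerivAt_energy b h t).deriv) t 0

theorem IsSmoothWave.hasDerivAt_integral_inner_timeDeriv (hu : IsSmoothWave u)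
    (b : OrthonormalBasis ι ℝ E) (h : ConeSupported a u) (t : ℝ) :
    HasDerivAt (fun t => ∫ z, inner ℝ (u (t, z)) (∂ₜ u (t, z)))
      (kineticEnergy u t - potentialEnergy b u t) t := by
  refine (h.hasDerivAt_integral_inner hu.contDiff
    (contDiff_dirDeriv hu.contDiff _) t).congr_deriv ?_
  rw [hu.integral_inner_timeDeriv_timeDeriv b h hu.contDiff, neg_add_eq_sub]
  simp only [real_inner_self_eq_norm_sq]
  rfl

end WaveEnergy

section SecondDerivative

theorem tendsto_atBot_of_deriv_le_neg {f f' : ℝ → ℝ} (hf : ∀ t, HasDerivAt f (f' t) t) {c : ℝ}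
    (hc : 0 < c) (h : ∀ᶠ t in atTop, f' t ≤ -c) : Tendsto f atTop atBot := by
  obtain ⟨T, hT⟩ := eventually_atTop.1 h
  have hle : ∀ t, T ≤ t → f t ≤ f T + -c * (t - T) := fun t ht => by
    have := (convex_Ici T).image_sub_le_mul_sub_of_deriv_le (f := f) (C := -c)
      (fun t _ => (hf t).continuousAt.continuousWithinAt)
      (fun t _ => (hf t).differentiableAt.differentiableWithinAt)
      (fun t ht => (hf t).deriv ▸ hT t (interior_subset ht)) T Set.self_mem_Ici t ht ht
    linarith
  refine tendsto_atBot_mono' atTop ((eventually_ge_atTop T).mono hle) ?_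
  exact tendsto_atBot_add_const_left _ _
    ((tendsto_atTop_add_const_right _ (-T) tendsto_id).const_mul_atTop_of_neg (neg_lt_zero.2 hc))

theorem nonneg_of_tendsto_second_deriv {f f' f'' : ℝ → ℝ} {L : ℝ}
    (hf : ∀ t, HasDerivAt f (f' t) t) (hf' : ∀ t, HasDerivAt f' (f'' t) t) (hnonneg : ∀ t, 0 ≤ f t)
    (hlim : Tendsto f'' atTop (𝓝 L)) : 0 ≤ L := by
  by_contra! hL
  have hf'_bot := tendsto_atBot_of_deriv_le_neg hf' (c := -L / 2) (by linarith)
    ((hlim.eventually_le_const (by linarith : L < L / 2)).mono fun t ht => by linarith)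
  have hf_bot := tendsto_atBot_of_deriv_le_neg hf one_pos (hf'_bot.eventually_le_atBot (-1))
  obtain ⟨t, ht⟩ := (hf_bot.eventually_lt_atBot 0).exists
  exact (hnonneg t).not_gt ht

end SecondDerivative

section Radiation

variable {E F : Type*} [NormedAddCommGroup E] [InnerProductSpace ℝ E] [NormedAddCommGroup F]
  [NormedSpace ℝ F] {w : ℝ × E → F} {G : ℝ × Metric.sphere (0 : E) 1 → F}

/-- `r w(s + r, r θ) → G(s, θ)` as `r → ∞`. -/
def HasRadiationLimit (w : ℝ × E → F) (G : ℝ × Metric.sphere (0 : E) 1 → F) : Prop :=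
  ∀ (s : ℝ) (θ : Metric.sphere (0 : E) 1),
    Tendsto (fun r : ℝ => r • w (s + r, r • (θ : E))) atTop (𝓝 (G (s, θ)))

theorem HasRadiationLimit.sub {w' : ℝ × E → F} {G' : ℝ × Metric.sphere (0 : E) 1 → F}
    (hG : HasRadiationLimit w G) (hG' : HasRadiationLimit w' G') :
    HasRadiationLimit (fun p => w p - w' p) (fun p => G p - G' p) := fun s θ => by
  simpa only [smul_sub] using (hG s θ).sub (hG' s θ)

/-- `|r w(t, r θ)|²` as a function of the retarded time `s = t - r` and of `θ`. -/
noncomputable def shellDensity (w : ℝ × E → F) (t : ℝ) (p : ℝ × Metric.sphere (0 : E) 1) :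
    ENNReal :=
  Set.indicator {p : ℝ × Metric.sphere (0 : E) 1 | p.1 < t}
    (fun p => ‖(t - p.1) • w (t, (t - p.1) • (p.2 : E))‖ₑ ^ 2) p

theorem HasRadiationLimit.tendsto_shellDensity (hG : HasRadiationLimit w G)
    (p : ℝ × Metric.sphere (0 : E) 1) :
    Tendsto (fun t => shellDensity w t p) atTop (𝓝 (‖G p‖ₑ ^ 2)) := by
  have hshift : Tendsto (fun t : ℝ => t - p.1) atTop atTop :=
    tendsto_atTop_add_const_right _ _ tendsto_id
  refine (((ENNReal.continuous_pow 2).tendsto _).comp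
    ((hG p.1 p.2).comp hshift).enorm).congr' ?_
  filter_upwards [eventually_gt_atTop p.1] with t ht
  rw [shellDensity, Set.indicator_of_mem (by exact ht)]
  simp

theorem shellDensity_le {a C : ℝ}
    (hsupp : ∀ t z, |t| + a < ‖z‖ ∨ ‖z‖ < |t| - a → w (t, z) = 0)
    (hdecay : ∀ t z, 1 ≤ t → ‖w (t, z)‖ ≤ C / t) {t : ℝ} (ht : 1 ≤ t)
    (p : ℝ × Metric.sphere (0 : E) 1) :
    shellDensity w t p ≤ (Set.Icc (-a) a ×ˢ Set.univ).indicator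
      (fun _ => ENNReal.ofReal ((1 + |a|) * C) ^ 2) p := by
  obtain ⟨s, θ⟩ := p
  refine Set.indicator_apply_le' (fun (hs : s < t) => ?_) fun _ => zero_le
  have ht0 : 0 < t := one_pos.trans_le ht
  have hn : ‖(t - s) • (θ : E)‖ = t - s := norm_smul_sphere (sub_nonneg.2 hs.le) θ
  by_cases hsa : s ∈ Set.Icc (-a) a
  · rw [Set.indicator_of_mem (by exact ⟨hsa, Set.mem_univ θ⟩), ← ofReal_norm, norm_smul,
      Real.norm_of_nonneg (sub_nonneg.2 hs.le)]
    have hts : t - s ≤ (1 + |a|) * t := by nlinarith [hsa.1, le_abs_self a, abs_nonneg a]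
    refine pow_le_pow_left' (ENNReal.ofReal_le_ofReal ?_) 2
    calc (t - s) * ‖w (t, (t - s) • (θ : E))‖ ≤ ((1 + |a|) * t) * (C / t) := by
          gcongr
          exact hdecay t _ ht
      _ = (1 + |a|) * C := by field_simp
  · have hzero : w (t, (t - s) • (θ : E)) = 0 := by
      apply hsupp
      rw [hn, abs_of_pos ht0]
      by_contra! hcon
      exact hsa ⟨by linarith [hcon.1], by linarith [hcon.2]⟩
    simp [hzero]

variable [FiniteDimensional ℝ E] [MeasurableSpace E] [BorelSpace E]

theorem measurable_shellDensity (hw : Continuous w) (t : ℝ) : Measurable (shellDensity w t) := by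
  have hcont : Continuous fun p : ℝ × Metric.sphere (0 : E) 1 =>
      ‖(t - p.1) • w (t, (t - p.1) • (p.2 : E))‖ₑ := by fun_prop
  exact (hcont.measurable.pow_const 2).indicator (measurableSet_lt measurable_fst measurable_const)

theorem HasRadiationLimit.measurable [MeasurableSpace F] [BorelSpace F] (hG : HasRadiationLimit w G)
    (hw : Continuous w) : Measurable G := by
  refine measurable_of_tendsto_metrizable
    (f := fun (n : ℕ) p => (n : ℝ) • w (p.1 + n, (n : ℝ) • (p.2 : E)))
    (fun n => Continuous.measurable (by fun_prop)) ?_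
  exact tendsto_pi_nhds.2 fun p => (hG p.1 p.2).comp tendsto_natCast_atTop_atTop

variable [hdim : Fact (Module.finrank ℝ E = 3)]
include hdim

theorem lintegral_shellDensity (hw : Continuous w) (t : ℝ) :
    ∫⁻ z, ‖w (t, z)‖ₑ ^ 2 = ∫⁻ p, shellDensity w t p ∂(volume.prod (surfaceMeasure E)) := by
  have : Nontrivial E := Module.nontrivial_of_finrank_pos (R := ℝ) (by simp [hdim.out])
  have hwt : Continuous fun z => ‖w (t, z)‖ₑ := by fun_prop
  rw [lintegral_prod_symm' _ (measurable_shellDensity hw t),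
    lintegral_eq_lintegral_sphere volume (hwt.measurable.pow_const 2)]
  refine lintegral_congr fun θ => ?_
  rw [← lintegral_indicator measurableSet_Ioi, ← lintegral_sub_left_eq_self _ t]
  refine lintegral_congr fun s => ?_
  by_cases hs : s < t
  · rw [Set.indicator_of_mem (Set.mem_Ioi.2 (sub_pos.2 hs)), shellDensity,
      Set.indicator_of_mem (by exact hs), enorm_smul, mul_pow, hdim.out,
      Real.enorm_of_nonneg (sub_nonneg.2 hs.le), ENNReal.ofReal_pow (sub_nonneg.2 hs.le)]
  · rw [Set.indicator_of_notMem (Set.notMem_Ioi.2 (sub_nonpos.2 (not_lt.1 hs))), shellDensity,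
      Set.indicator_of_notMem (by exact hs)]

theorem HasRadiationLimit.tendsto_lintegral (hG : HasRadiationLimit w G) (hw : Continuous w)
    {a C : ℝ} (hsupp : ∀ t z, |t| + a < ‖z‖ ∨ ‖z‖ < |t| - a → w (t, z) = 0)
    (hdecay : ∀ t z, 1 ≤ t → ‖w (t, z)‖ ≤ C / t) :
    Tendsto (fun t => ∫⁻ z, ‖w (t, z)‖ₑ ^ 2) atTop
      (𝓝 (∫⁻ p, ‖G p‖ₑ ^ 2 ∂(volume.prod (surfaceMeasure E)))) := by
  simp only [lintegral_shellDensity hw]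
  refine tendsto_lintegral_filter_of_dominated_convergence _
    (Eventually.of_forall fun t => measurable_shellDensity hw t)
    ((eventually_ge_atTop 1).mono fun t ht =>
      Eventually.of_forall (shellDensity_le hsupp hdecay ht)) ?_
    (Eventually.of_forall hG.tendsto_shellDensity)
  rw [lintegral_indicator_const (measurableSet_Icc.prod MeasurableSet.univ), Measure.prod_prod]
  have hvol : volume (Set.Icc (-a) a) * surfaceMeasure E Set.univ ≠ ⊤ :=
    ENNReal.mul_ne_top measure_Icc_lt_top.ne (measure_ne_top _ _)
  exact ENNReal.mul_ne_top (ENNReal.pow_ne_top ENNReal.ofReal_ne_top) hvol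

end Radiation

section EnergyBound

theorem ofReal_integral_norm_sq {X F : Type*} [TopologicalSpace X] [MeasurableSpace X]
    [OpensMeasurableSpace X] {μ : Measure X} [IsFiniteMeasureOnCompacts μ] [NormedAddCommGroup F]
    {f : X → F} (hf : Continuous f) (hc : HasCompactSupport f) :
    ENNReal.ofReal (∫ x, ‖f x‖ ^ 2 ∂μ) = ∫⁻ x, ‖f x‖ₑ ^ 2 ∂μ := by
  have hsupp : HasCompactSupport fun x => ‖f x‖ ^ 2 :=
    hc.comp_left (g := fun y : F => ‖y‖ ^ 2) (by simp)
  have h_int : Integrable (fun x => ‖f x‖ ^ 2) μ :=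
    (hf.norm.pow 2).integrable_of_hasCompactSupport hsupp
  rw [ofReal_integral_eq_lintegral_ofReal h_int (Eventually.of_forall fun x => by positivity)]
  exact lintegral_congr fun x => by rw [ENNReal.ofReal_pow (norm_nonneg _), ofReal_norm]

variable {E F ι : Type*} [NormedAddCommGroup E] [InnerProductSpace ℝ E] [FiniteDimensional ℝ E]
  [MeasurableSpace E] [BorelSpace E] [NormedAddCommGroup F] [InnerProductSpace ℝ F] [Fintype ι]
  {a L : ℝ} {u : ℝ × E → F}

/-- The virial argument: the second derivative of `∫ ‖u‖²` is `2 K - 2 P = 4 K - 2 (K + P)`, where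
`K + P` is conserved, and a nonnegative function is not eventually strongly concave. -/
theorem IsSmoothWave.energy_le_of_tendsto_kineticEnergy (hu : IsSmoothWave u)
    (b : OrthonormalBasis ι ℝ E) (h : ConeSupported a u)
    (hL : Tendsto (kineticEnergy u) atTop (𝓝 L)) :
    kineticEnergy u 0 + potentialEnergy b u 0 ≤ 2 * L := by
  have hvirial : ∀ t, 2 * (kineticEnergy u t - potentialEnergy b u t) =
      4 * kineticEnergy u t - 2 * (kineticEnergy u 0 + potentialEnergy b u 0) := fun t => by
    linarith [hu.energy_conservation b h t]
  have hnonneg := nonneg_of_tendsto_second_deriv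
    (fun t => h.hasDerivAt_integral_norm_sq (μ := volume) hu.contDiff t)
    (fun t => ((hu.hasDerivAt_integral_inner_timeDeriv b h t).const_mul 2).congr_deriv (hvirial t))
    (fun t => integral_nonneg fun z => by positivity)
    ((hL.const_mul 4).sub_const (2 * (kineticEnergy u 0 + potentialEnergy b u 0)))
  linarith

theorem IsSmoothWave.lintegral_energy_le [CompleteSpace F] [Fact (Module.finrank ℝ E = 3)]
    (hu : IsSmoothWave u) (h : DataSupportedIn a u) (b : OrthonormalBasis ι ℝ E)
    {G : ℝ × Metric.sphere (0 : E) 1 → F} (hG : HasRadiationLimit (∂ₜ u) G) :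
    (∫⁻ z, ‖∂ₜ u (0, z)‖ₑ ^ 2) + ∑ i, ∫⁻ z, ‖∂ₓ[b i] u (0, z)‖ₑ ^ 2 ≤
      2 * ∫⁻ p, ‖G p‖ₑ ^ 2 ∂(volume.prod (surfaceMeasure E)) := by
  have hcone := hu.coneSupported h
  have hlintegral : ∀ w t, ENNReal.ofReal (∫ z, ‖dirDeriv w u (t, z)‖ ^ 2) =
      ∫⁻ z, ‖dirDeriv w u (t, z)‖ₑ ^ 2 := fun w t =>
    ofReal_integral_norm_sq (contDiff_timeSlice (contDiff_dirDeriv hu.contDiff w) t).continuous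
      ((hcone.dirDeriv w).hasCompactSupport t)
  have hK_nonneg : ∀ t, 0 ≤ kineticEnergy u t := fun t => integral_nonneg fun z => by positivity
  have hP_nonneg : ∀ i, 0 ≤ ∫ z, ‖∂ₓ[b i] u (0, z)‖ ^ 2 :=
    fun i => integral_nonneg fun z => by positivity
  obtain ⟨C, hdecay⟩ := hu.timeDeriv.exists_decay (h.timeDeriv hu)
  have hlim := hG.tendsto_lintegral (contDiff_dirDeriv hu.contDiff _).continuous
    (fun t z hz => hu.timeDeriv.huygens (h.timeDeriv hu) hz) hdecay
  set L := ∫⁻ p, ‖G p‖ₑ ^ 2 ∂(volume.prod (surfaceMeasure E))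
  rcases eq_or_ne L ⊤ with hLtop | hLtop
  · simp [hLtop]
  have hK_lim : Tendsto (kineticEnergy u) atTop (𝓝 L.toReal) := by
    refine ((ENNReal.tendsto_toReal hLtop).comp hlim).congr fun t => ?_
    rw [Function.comp_apply, ← hlintegral]
    exact ENNReal.toReal_ofReal (hK_nonneg t)
  have hle := ENNReal.ofReal_le_ofReal (hu.energy_le_of_tendsto_kineticEnergy b hcone hK_lim)
  rw [ENNReal.ofReal_mul zero_le_two, ENNReal.ofReal_toReal hLtop, ENNReal.ofReal_ofNat,
    potentialEnergy,
    ENNReal.ofReal_add (hK_nonneg 0) (Finset.sum_nonneg fun i _ => hP_nonneg i),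
    ENNReal.ofReal_sum_of_nonneg fun i _ => hP_nonneg i] at hle
  simpa only [kineticEnergy, hlintegral] using hle

end EnergyBound

section WeakDerivative

variable {E F : Type*} [NormedAddCommGroup E] [NormedSpace ℝ E] [FiniteDimensional ℝ E]
  [MeasurableSpace E] [BorelSpace E] [NormedAddCommGroup F] [NormedSpace ℝ F]
  {μ : Measure E} [μ.IsAddHaarMeasure] {f : E → F} {e : E}

theorem integral_translate_smul_eq (hf : LocallyIntegrable f μ)
    (h : ∀ χ : E → ℝ, ContDiff ℝ ∞ χ → HasCompactSupport χ → ∫ z, dirDeriv e χ z • f z ∂μ = 0)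
    {χ : E → ℝ} (hχ : ContDiff ℝ ∞ χ) (hχc : HasCompactSupport χ) (τ : ℝ) :
    ∫ z, χ (z - τ • e) • f z ∂μ = ∫ z, χ z • f z ∂μ := by
  set L : F →L[ℝ] ℝ →L[ℝ] F := (ContinuousLinearMap.lsmul ℝ ℝ).flip with hL
  set g : E → ℝ := fun y => χ (-y) with hg
  have hgs : ContDiff ℝ ∞ g := hχ.comp contDiff_neg
  have hgc : HasCompactSupport g := hχc.comp_homeomorph (Homeomorph.neg E)
  have hflip : ∀ x t, dirDeriv e g (x - t) = -dirDeriv e (fun z => χ (z - x)) t := fun x t => by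
    have hneg := dirDeriv_comp hχ (hasFDerivAt_id (x - t)).fun_neg e
    have hsub := dirDeriv_comp hχ ((hasFDerivAt_id t).sub_const x) e
    simp only [id_eq, neg_apply, ContinuousLinearMap.id_apply, neg_sub] at hneg hsub
    rw [hneg, hsub, dirDeriv_neg_left]
  have hderiv : ∀ x, fderiv ℝ (convolution f g L μ) x e = 0 := fun x => by
    rw [(hgc.hasFDerivAt_convolution_right L hf (hgs.of_le (by simp)) x).fderiv,
      convolution_precompR_apply L hf (hgc.fderiv ℝ) (hgs.continuous_fderiv (by simp))]
    have htest := h _ (hχ.comp (contDiff_id.sub contDiff_const))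
      (hχc.comp_homeomorph (Homeomorph.subRight x))
    calc ∫ t, dirDeriv e g (x - t) • f t ∂μ
        = -∫ t, dirDeriv e (fun z => χ (z - x)) t • f t ∂μ := by
          simp only [hflip, neg_smul, integral_neg]
      _ = 0 := by rw [neg_eq_zero]; exact htest
  have hconst : ∀ s, HasDerivAt (fun s : ℝ => convolution f g L μ (s • e)) 0 s := fun s => by
    have hline : HasDerivAt (fun s : ℝ => s • e) e s := by
      simpa using (hasDerivAt_id s).smul_const e
    rw [← hderiv (s • e)]
    exact (hgc.hasFDerivAt_convolution_right L hf (hgs.of_le (by simp))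
      (s • e)).differentiableAt.hasFDerivAt.comp_hasDerivAt s hline
  have heq := is_const_of_deriv_eq_zero (fun s => (hconst s).differentiableAt)
    (fun s => (hconst s).deriv) τ 0
  simpa [convolution_def, hL, hg] using heq

omit [FiniteDimensional ℝ E] [MeasurableSpace E] [BorelSpace E] in
theorem exists_translate_disjoint {k : E → F} {χ : E → ℝ} (hk : HasCompactSupport k)
    (hχ : HasCompactSupport χ) (he : e ≠ 0) : ∃ τ : ℝ, ∀ z, χ (z - τ • e) • k z = 0 := by
  obtain ⟨R, hR⟩ := (hk.isCompact.isBounded.sub hχ.isCompact.isBounded).exists_norm_le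
  refine ⟨(|R| + 1) / ‖e‖, fun z => ?_⟩
  by_contra hne
  obtain ⟨hχz, hkz⟩ := smul_ne_zero_iff.1 hne
  have hle := hR _ (Set.sub_mem_sub (subset_tsupport k hkz) (subset_tsupport χ hχz))
  rw [sub_sub_cancel, norm_smul, Real.norm_of_nonneg (by positivity),
    div_mul_cancel₀ _ (norm_ne_zero_iff.2 he)] at hle
  linarith [le_abs_self R]

omit [NormedSpace ℝ E] [FiniteDimensional ℝ E] [NormedAddCommGroup E] [BorelSpace E]
  [μ.IsAddHaarMeasure] in
theorem enorm_integral_smul_le_eLpNorm_mul {𝕜 : Type*} [NormedField 𝕜] [NormedSpace 𝕜 F]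
    {p q : ENNReal} [p.HolderConjugate q] {χ : E → 𝕜}
    (hχ : AEStronglyMeasurable χ μ) (hf : AEStronglyMeasurable f μ) :
    ‖∫ z, χ z • f z ∂μ‖ₑ ≤ eLpNorm χ p μ * eLpNorm f q μ := by
  refine (enorm_integral_le_lintegral_enorm _).trans ?_
  rw [← eLpNorm_one_eq_lintegral_enorm]
  exact eLpNorm_smul_le_mul_eLpNorm hf hχ

/-- A function that does not change in direction `e` has, against a test function `χ`, the same
integral as against translates of `χ`, which leave the support of any compactly supported `L^p`
approximation of `f`. -/
theorem ae_eq_zero_of_integral_dirDeriv_smul_eq_zero [CompleteSpace F] {p : ENNReal} (hp : 1 ≤ p)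
    (hp_top : p ≠ ⊤) (hf : MemLp f p μ) (he : e ≠ 0)
    (h : ∀ χ : E → ℝ, ContDiff ℝ ∞ χ → HasCompactSupport χ → ∫ z, dirDeriv e χ z • f z ∂μ = 0) :
    ∀ᵐ z ∂μ, f z = 0 := by
  have hloc := hf.locallyIntegrable hp
  refine ae_eq_zero_of_integral_contDiff_smul_eq_zero hloc fun χ hχ hχc => ?_
  have : p.HolderConjugate p.conjExponent := .conjExponent hp
  have hχq : MemLp χ p.conjExponent μ := hχ.continuous.memLp_of_hasCompactSupport hχc
  have hbound : ∀ ε : ENNReal, ε ≠ 0 →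
      ‖∫ z, χ z • f z ∂μ‖ₑ ≤ eLpNorm χ p.conjExponent μ * ε := fun ε hε => by
    obtain ⟨k, hkc, hk, -, hkp⟩ := hf.exists_hasCompactSupport_eLpNorm_sub_le hp_top hε
    obtain ⟨τ, hτ⟩ := exists_translate_disjoint hkc hχc he
    have hχτ : Continuous fun z => χ (z - τ • e) := hχ.continuous.comp (by fun_prop)
    have htranslate : eLpNorm (fun z => χ (z - τ • e)) p.conjExponent μ =
        eLpNorm χ p.conjExponent μ :=
      eLpNorm_comp_measurePreserving hχ.continuous.aestronglyMeasurable
        (measurePreserving_sub_right μ (τ • e))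
    calc ‖∫ z, χ z • f z ∂μ‖ₑ = ‖∫ z, χ (z - τ • e) • (f - k) z ∂μ‖ₑ := by
          rw [← integral_translate_smul_eq hloc h hχ hχc τ]
          simp only [Pi.sub_apply, smul_sub, hτ, sub_zero]
      _ ≤ eLpNorm (fun z => χ (z - τ • e)) p.conjExponent μ * eLpNorm (f - k) p μ :=
          enorm_integral_smul_le_eLpNorm_mul hχτ.aestronglyMeasurable
            (hf.aestronglyMeasurable.sub hkp.aestronglyMeasurable)
      _ ≤ eLpNorm χ p.conjExponent μ * ε := by rw [htranslate]; gcongr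
  have hlim : Tendsto (fun n : ℕ => eLpNorm χ p.conjExponent μ * (n : ENNReal)⁻¹) atTop (𝓝 0) := by
    simpa using ENNReal.Tendsto.const_mul ENNReal.tendsto_inv_nat_nhds_zero
      (Or.inr hχq.eLpNorm_ne_top)
  rw [← enorm_eq_zero, ← nonpos_iff_eq_zero]
  exact ge_of_tendsto' hlim fun n => hbound _ (ENNReal.inv_ne_zero.2 (ENNReal.natCast_ne_top n))

end WeakDerivative

section EnergyEstimate

variable {φ ψ φ' ψ' : Space3 → ℂ} {u : ℝ × Space3 → ℂ} {G G' : ℝ × Sphere2 → ℂ}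

instance finrank_space3 : Fact (Module.finrank ℝ Space3 = 3) :=
  ⟨finrank_euclideanSpace_fin⟩

theorem iteratedDeriv_two_time (hu : ContDiff ℝ ∞ u) (t : ℝ) (z : Space3) :
    iteratedDeriv 2 (fun τ : ℝ => u (τ, z)) t = ∂ₜ (∂ₜ u) (t, z) := by
  have hderiv : deriv (fun τ : ℝ => u (τ, z)) = fun τ => ∂ₜ u (τ, z) :=
    funext fun τ => (hasDerivAt_timeDeriv hu τ z).deriv
  rw [iteratedDeriv_succ, iteratedDeriv_one, hderiv]
  exact (hasDerivAt_timeDeriv (contDiff_dirDeriv hu _) t z).deriv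

theorem isWaveSolution_iff : IsWaveSolution φ ψ u ↔
    IsSmoothWave u ∧ (∀ z, u (0, z) = φ z) ∧ ∀ z, ∂ₜ u (0, z) = ψ z := by
  constructor
  · intro h
    refine ⟨⟨h.contDiff, fun t z => ?_⟩, h.initial_value, fun z => ?_⟩
    · rw [← iteratedDeriv_two_time h.contDiff, h.wave_eq]
    · rw [← h.initial_velocity, (hasDerivAt_timeDeriv h.contDiff 0 z).deriv]
  · rintro ⟨h, hφ, hψ⟩
    refine ⟨h.contDiff, fun t z => ?_, hφ, fun z => ?_⟩
    · rw [iteratedDeriv_two_time h.contDiff, h.wave_eq]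
    · rw [(hasDerivAt_timeDeriv h.contDiff 0 z).deriv, hψ]

theorem isClassicalRadiationField_iff : IsClassicalRadiationField φ ψ G ↔
    ∃ u, IsSmoothWave u ∧ (∀ z, u (0, z) = φ z) ∧ (∀ z, ∂ₜ u (0, z) = ψ z) ∧
      HasRadiationLimit (∂ₜ u) G := by
  refine exists_congr fun u => ?_
  simp only [isWaveSolution_iff, and_assoc]
  refine and_congr_right fun hu => and_congr_right fun _ => and_congr_right fun _ => ?_
  simp only [HasRadiationLimit, (hasDerivAt_timeDeriv hu.contDiff _ _).deriv, Complex.real_smul]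

theorem IsClassicalRadiationField.sub (h : IsClassicalRadiationField φ ψ G)
    (h' : IsClassicalRadiationField φ' ψ' G') :
    IsClassicalRadiationField (fun z => φ z - φ' z) (fun z => ψ z - ψ' z)
      (fun p => G p - G' p) := by
  rw [isClassicalRadiationField_iff] at h h' ⊢
  obtain ⟨u, hu, hφ, hψ, hG⟩ := h
  obtain ⟨u', hu', hφ', hψ', hG'⟩ := h'
  refine ⟨fun p => u p - u' p, hu.sub hu', fun z => by simp only [hφ, hφ'], ?_, ?_⟩
  all_goals rw [dirDeriv_sub hu.contDiff hu'.contDiff]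
  · exact fun z => by simp only [hψ, hψ']
  · exact hG.sub hG'

theorem IsClassicalRadiationField.measurable (h : IsClassicalRadiationField φ ψ G) :
    Measurable G := by
  obtain ⟨u, hu, -, -, hG⟩ := isClassicalRadiationField_iff.1 h
  exact hG.measurable (contDiff_dirDeriv hu.contDiff _).continuous

theorem IsTestFunction.sub (h : IsTestFunction φ) (h' : IsTestFunction φ') :
    IsTestFunction (fun z => φ z - φ' z) :=
  ⟨h.1.sub h'.1, h.2.sub h'.2⟩

theorem IsTestFunction.continuous (h : IsTestFunction φ) : Continuous φ :=
  h.1.continuous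

theorem IsTestFunction.memLp (h : IsTestFunction φ) (p : ENNReal) : MemLp φ p volume :=
  h.continuous.memLp_of_hasCompactSupport h.2

theorem gradient3_apply (φ : Space3 → ℂ) (z : Space3) (i : Fin 3) :
    gradient3 φ z i = dirDeriv (EuclideanSpace.basisFun (Fin 3) ℝ i) φ z := by
  rw [EuclideanSpace.basisFun_apply]
  rfl

theorem gradient3_sub (hφ : ContDiff ℝ ∞ φ) (hφ' : ContDiff ℝ ∞ φ') :
    gradient3 (fun z => φ z - φ' z) = fun z => gradient3 φ z - gradient3 φ' z := by
  funext z
  ext i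
  simp only [PiLp.sub_apply, gradient3_apply, dirDeriv_sub hφ hφ']

theorem IsTestFunction.continuous_gradient3 (h : IsTestFunction φ) : Continuous (gradient3 φ) := by
  have hfderiv := h.1.continuous_fderiv (by simp)
  unfold gradient3
  fun_prop

theorem IsTestFunction.memLp_gradient3 (h : IsTestFunction φ) (p : ENNReal) :
    MemLp (gradient3 φ) p volume := by
  refine h.continuous_gradient3.memLp_of_hasCompactSupport
    ((h.2.fderiv ℝ).mono fun z hz hfderiv => hz ?_)
  ext i
  simp [gradient3, hfderiv]

theorem eLpNorm_two_sq {X F : Type*} [MeasurableSpace X] [NormedAddCommGroup F] (f : X → F)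
    (μ : Measure X) : eLpNorm f 2 μ ^ 2 = ∫⁻ x, ‖f x‖ₑ ^ 2 ∂μ := by
  have h := eLpNorm_nnreal_pow_eq_lintegral (f := f) (μ := μ) (p := 2) two_ne_zero
  simpa only [ENNReal.coe_ofNat, NNReal.coe_ofNat, ENNReal.rpow_ofNat] using h

theorem enorm_sq_eq_sum_enorm_sq {ι 𝕜 : Type*} [Fintype ι] [RCLike 𝕜] (x : EuclideanSpace 𝕜 ι) :
    ‖x‖ₑ ^ 2 = ∑ i, ‖x i‖ₑ ^ 2 := by
  simp only [← ofReal_norm]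
  rw [← ENNReal.ofReal_pow (norm_nonneg _), EuclideanSpace.norm_sq_eq,
    ENNReal.ofReal_sum_of_nonneg fun i _ => by positivity]
  exact Finset.sum_congr rfl fun i _ => ENNReal.ofReal_pow (norm_nonneg _) _

theorem IsTestFunction.eLpNorm_gradient3_sq (hφ : IsTestFunction φ) :
    eLpNorm (gradient3 φ) 2 volume ^ 2 =
      ∑ i, ∫⁻ z, ‖dirDeriv (EuclideanSpace.basisFun (Fin 3) ℝ i) φ z‖ₑ ^ 2 := by
  simp only [eLpNorm_two_sq, enorm_sq_eq_sum_enorm_sq, gradient3_apply]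
  exact lintegral_finsetSum' _ fun i _ =>
    ((contDiff_dirDeriv hφ.1 _).continuous.measurable.enorm.pow_const 2).aemeasurable

theorem IsClassicalRadiationField.energy_le (h : IsClassicalRadiationField φ ψ G)
    (hφ : IsTestFunction φ) (hψ : IsTestFunction ψ) :
    eLpNorm ψ 2 volume ^ 2 + eLpNorm (gradient3 φ) 2 volume ^ 2 ≤
      2 * eLpNorm G 2 cylinderMeasure ^ 2 := by
  obtain ⟨u, hu, huφ, huψ, hG⟩ := isClassicalRadiationField_iff.1 h
  obtain ⟨a, -, ha⟩ := hφ.2.exists_pos_le_norm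
  obtain ⟨b, -, hb⟩ := hψ.2.exists_pos_le_norm
  have hdata : DataSupportedIn (max a b) u := fun z hz => by
    rw [huφ, huψ]
    exact ⟨ha z ((le_max_left a b).trans hz.le), hb z ((le_max_right a b).trans hz.le)⟩
  have hslice : ∀ v z, dirDeriv v φ z = ∂ₓ[v] u (0, z) := fun v z => by
    rw [← congrFun (dirDeriv_timeSlice hu.contDiff 0 v) z, funext huφ]
  have henergy := hu.lintegral_energy_le hdata (EuclideanSpace.basisFun (Fin 3) ℝ) hG
  simp only [huψ, ← hslice] at henergy
  rwa [hφ.eLpNorm_gradient3_sq, eLpNorm_two_sq, eLpNorm_two_sq]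

theorem le_two_mul_of_sq_le {a b : ENNReal} (h : a ^ 2 ≤ 2 * b ^ 2) : a ≤ 2 * b := by
  rw [← ENNReal.pow_le_pow_left_iff two_ne_zero, mul_pow]
  refine h.trans ?_
  gcongr
  norm_num

theorem IsClassicalRadiationField.eLpNorm_gradient3_le (h : IsClassicalRadiationField φ ψ G)
    (hφ : IsTestFunction φ) (hψ : IsTestFunction ψ) :
    eLpNorm (gradient3 φ) 2 volume ≤ 2 * eLpNorm G 2 cylinderMeasure :=
  le_two_mul_of_sq_le (le_add_self.trans (h.energy_le hφ hψ))

theorem IsClassicalRadiationField.eLpNorm_velocity_le (h : IsClassicalRadiationField φ ψ G)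
    (hφ : IsTestFunction φ) (hψ : IsTestFunction ψ) :
    eLpNorm ψ 2 volume ≤ 2 * eLpNorm G 2 cylinderMeasure :=
  le_two_mul_of_sq_le (le_self_add.trans (h.energy_le hφ hψ))

end EnergyEstimate

section Uniqueness

theorem tendsto_eLpNorm_sub_trans {X F : Type*} [MeasurableSpace X] [NormedAddCommGroup F]
    {μ : Measure X} {p : ENNReal} (hp : 1 ≤ p) {ι : Type*} {l : Filter ι} {f g h : ι → X → F}
    (hf : ∀ n, AEStronglyMeasurable (f n) μ) (hg : ∀ n, AEStronglyMeasurable (g n) μ)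
    (hh : ∀ n, AEStronglyMeasurable (h n) μ)
    (hfg : Tendsto (fun n => eLpNorm (fun x => f n x - g n x) p μ) l (𝓝 0))
    (hgh : Tendsto (fun n => eLpNorm (fun x => g n x - h n x) p μ) l (𝓝 0)) :
    Tendsto (fun n => eLpNorm (fun x => f n x - h n x) p μ) l (𝓝 0) := by
  refine tendsto_of_tendsto_of_tendsto_of_le_of_le tendsto_const_nhds
    (by simpa using hfg.add hgh) (fun n => zero_le) fun n => ?_
  have hsum : (fun x => f n x - h n x) = (f n - g n) + (g n - h n) :=
    (sub_add_sub_cancel (f n) (g n) (h n)).symm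
  rw [hsum]
  exact eLpNorm_add_le ((hf n).sub (hg n)) ((hg n).sub (hh n)) hp

theorem ae_eq_of_tendsto_eLpNorm {X F : Type*} [MeasurableSpace X] [NormedAddCommGroup F]
    {μ : Measure X} {p : ENNReal} (hp : p ≠ 0) {A : ℕ → X → F} {f g : X → F}
    (hA : ∀ n, AEStronglyMeasurable (A n) μ) (hf : AEStronglyMeasurable f μ)
    (hg : AEStronglyMeasurable g μ)
    (hAf : Tendsto (fun n => eLpNorm (fun x => A n x - f x) p μ) atTop (𝓝 0))
    (hAg : Tendsto (fun n => eLpNorm (fun x => A n x - g x) p μ) atTop (𝓝 0)) : f =ᵐ[μ] g :=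
  tendstoInMeasure_ae_unique (tendstoInMeasure_of_tendsto_eLpNorm hp hA hf hAf)
    (tendstoInMeasure_of_tendsto_eLpNorm hp hA hg hAg)

theorem tendsto_eLpNorm_sub_of_radiationField {ι : Type*} {l : Filter ι}
    {φ ψ φ' ψ' : ι → Space3 → ℂ} {G G' : ι → ℝ × Sphere2 → ℂ}
    (htest : ∀ n, IsTestFunction (φ n) ∧ IsTestFunction (ψ n))
    (htest' : ∀ n, IsTestFunction (φ' n) ∧ IsTestFunction (ψ' n))
    (h : ∀ n, IsClassicalRadiationField (φ n) (ψ n) (G n))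
    (h' : ∀ n, IsClassicalRadiationField (φ' n) (ψ' n) (G' n))
    (hG : Tendsto (fun n => eLpNorm (fun p => G n p - G' n p) 2 cylinderMeasure) l (𝓝 0)) :
    Tendsto (fun n => eLpNorm (fun z => gradient3 (φ n) z - gradient3 (φ' n) z) 2 volume) l (𝓝 0) ∧
      Tendsto (fun n => eLpNorm (fun z => ψ n z - ψ' n z) 2 volume) l (𝓝 0) := by
  have hbound : Tendsto (fun n => 2 * eLpNorm (fun p => G n p - G' n p) 2 cylinderMeasure) l
      (𝓝 0) := by
    simpa using ENNReal.Tendsto.const_mul hG (Or.inr ENNReal.ofNat_ne_top)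
  have hφ := fun n => (htest n).1.sub (htest' n).1
  have hψ := fun n => (htest n).2.sub (htest' n).2
  refine ⟨tendsto_of_tendsto_of_tendsto_of_le_of_le tendsto_const_nhds hbound
    (fun n => zero_le) fun n => ?_, tendsto_of_tendsto_of_tendsto_of_le_of_le tendsto_const_nhds
    hbound (fun n => zero_le) fun n => ((h n).sub (h' n)).eLpNorm_velocity_le (hφ n) (hψ n)⟩
  have hgrad := ((h n).sub (h' n)).eLpNorm_gradient3_le (hφ n) (hψ n)
  rwa [gradient3_sub (htest n).1.1 (htest' n).1.1] at hgrad

theorem HasWeakGradient.integral_dirDeriv_smul {φ : Space3 → ℂ}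
    {g : Space3 → EuclideanSpace ℂ (Fin 3)} (h : HasWeakGradient φ g) {χ : Space3 → ℝ}
    (hχ : ContDiff ℝ ∞ χ) (hχc : HasCompactSupport χ) (i : Fin 3) :
    ∫ z, dirDeriv (EuclideanSpace.basisFun (Fin 3) ℝ i) χ z • φ z = -∫ z, χ z • g z i := by
  have htest : IsTestFunction fun z => (χ z : ℂ) :=
    ⟨Complex.ofRealCLM.contDiff.comp hχ, hχc.comp_left (g := fun x : ℝ => (x : ℂ)) (by simp)⟩
  have hofReal : ∀ v z, dirDeriv v (fun z => (χ z : ℂ)) z = ((dirDeriv v χ z : ℝ) : ℂ) := fun v z =>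
    congrArg (fun L => L v) (Complex.ofRealCLM.hasFDerivAt.comp z
      (hχ.differentiable (by simp) z).hasFDerivAt).fderiv
  simpa only [gradient3_apply, hofReal, Complex.real_smul, mul_comm] using h.integral_eq _ htest i

theorem HasWeakGradient.ae_eq {p : ENNReal} (hp : 1 ≤ p) (hp_top : p ≠ ⊤) {φ φ' : Space3 → ℂ}
    {g g' : Space3 → EuclideanSpace ℂ (Fin 3)} (h : HasWeakGradient φ g)
    (h' : HasWeakGradient φ' g') (hg : g =ᵐ[volume] g') (hφ : MemLp φ p volume)
    (hφ' : MemLp φ' p volume) : φ =ᵐ[volume] φ' := by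
  set e := EuclideanSpace.basisFun (Fin 3) ℝ 0
  have he : e ≠ 0 := (EuclideanSpace.basisFun (Fin 3) ℝ).toBasis.ne_zero 0
  suffices hzero : ∀ᵐ z, (φ - φ') z = 0 from hzero.mono fun z hz => sub_eq_zero.1 hz
  refine ae_eq_zero_of_integral_dirDeriv_smul_eq_zero hp hp_top (hφ.sub hφ') he fun χ hχ hχc => ?_
  have h_int : ∀ {f : Space3 → ℂ}, LocallyIntegrable f volume →
      Integrable (fun z => dirDeriv e χ z • f z) := fun hf =>
    hf.integrable_smul_left_of_hasCompactSupport (contDiff_dirDeriv hχ e).continuous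
      (hasCompactSupport_dirDeriv hχc e)
  have hgg' : ∫ z, χ z • g z 0 = ∫ z, χ z • g' z 0 :=
    integral_congr_ae (hg.mono fun z hz => by simp only [hz])
  simp only [Pi.sub_apply, smul_sub]
  rw [integral_sub (h_int h.locallyIntegrable) (h_int h'.locallyIntegrable),
    h.integral_dirDeriv_smul hχ hχc, h'.integral_dirDeriv_smul hχ hχc, hgg', sub_self]

theorem IsRadiationField.ae_unique {φ ψ φ' ψ' : Space3 → ℂ} {G : ℝ × Sphere2 → ℂ}
    (h : IsRadiationField φ ψ G) (h' : IsRadiationField φ' ψ' G) :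
    φ =ᵐ[volume] φ' ∧ ψ =ᵐ[volume] ψ' := by
  obtain ⟨⟨⟨hφ, -⟩, hψ⟩, hG, φn, ψn, Gn, htest, ⟨⟨g, hφg, hg, hgn⟩, hψn⟩, hclass, hGn⟩ := h
  obtain ⟨⟨⟨hφ', -⟩, hψ'⟩, -, φn', ψn', Gn', htest', ⟨⟨g', hφg', hg', hgn'⟩, hψn'⟩, hclass',
    hGn'⟩ := h'
  have hGm := fun n => (hclass n).measurable.aestronglyMeasurable (μ := cylinderMeasure)
  have hGm' := fun n => (hclass' n).measurable.aestronglyMeasurable (μ := cylinderMeasure)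
  have hGsub := tendsto_eLpNorm_sub_trans one_le_two hGm (fun _ => hG.aestronglyMeasurable) hGm' hGn
    (hGn'.congr fun n => eLpNorm_sub_comm (Gn' n) G 2 cylinderMeasure)
  obtain ⟨hgrad, hvel⟩ :=
    tendsto_eLpNorm_sub_of_radiationField htest htest' hclass hclass' hGsub
  have hgm := fun n => ((htest n).1.memLp_gradient3 2).aestronglyMeasurable
  have hgm' := fun n => ((htest' n).1.memLp_gradient3 2).aestronglyMeasurable
  have hψm := fun n => ((htest n).2.memLp 2).aestronglyMeasurable
  have hψm' := fun n => ((htest' n).2.memLp 2).aestronglyMeasurable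
  constructor
  · refine hφg.ae_eq (by norm_num) (by norm_num) hφg' ?_ hφ hφ'
    exact ae_eq_of_tendsto_eLpNorm two_ne_zero hgm hg.aestronglyMeasurable hg'.aestronglyMeasurable
      hgn (tendsto_eLpNorm_sub_trans one_le_two hgm hgm' (fun _ => hg'.aestronglyMeasurable) hgrad
        hgn')
  · exact ae_eq_of_tendsto_eLpNorm two_ne_zero hψm hψ.aestronglyMeasurable hψ'.aestronglyMeasurable
      hψn (tendsto_eLpNorm_sub_trans one_le_two hψm hψm' (fun _ => hψ'.aestronglyMeasurable) hvel
        hψn')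

end Uniqueness

section PlaneWaves

variable {E F : Type*} [NormedAddCommGroup E] [InnerProductSpace ℝ E] [NormedAddCommGroup F]
  [NormedSpace ℝ F] {K : ℝ → F}

/-- The plane wave with profile `K` travelling in the direction `-e`. -/
def planeWave (K : ℝ → F) (e : E) (p : ℝ × E) : F :=
  K (p.1 + inner ℝ p.2 e)

theorem contDiff_planeWave_uncurry (hK : ContDiff ℝ ∞ K) :
    ContDiff ℝ ∞ (fun q : (ℝ × E) × E => planeWave K q.2 q.1) :=
  hK.comp (contDiff_fst.fst.add (contDiff_fst.snd.inner ℝ contDiff_snd))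

theorem contDiff_planeWave (hK : ContDiff ℝ ∞ K) (e : E) : ContDiff ℝ ∞ (planeWave K e) :=
  (contDiff_planeWave_uncurry hK).comp (contDiff_prodMk_left e)

theorem dirDeriv_planeWave (hK : ContDiff ℝ ∞ K) (e : E) (v : ℝ × E) :
    dirDeriv v (planeWave K e) = planeWave (fun s => (v.1 + inner ℝ v.2 e) • deriv K s) e := by
  funext p
  set phase := ContinuousLinearMap.fst ℝ ℝ E + (innerSL ℝ e).comp (ContinuousLinearMap.snd ℝ ℝ E)
  have hphase : ∀ q : ℝ × E, phase q = q.1 + inner ℝ q.2 e := fun q => by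
    simp [phase, real_inner_comm]
  have h := dirDeriv_comp hK (phase.hasFDerivAt (x := p)) v
  simp only [hphase] at h
  exact h.trans (by simp [dirDeriv, planeWave])

theorem isSmoothWave_planeWave [FiniteDimensional ℝ E] (hK : ContDiff ℝ ∞ K) {e : E}
    (he : ‖e‖ = 1) : IsSmoothWave (planeWave K e) := by
  have b := stdOrthonormalBasis ℝ E
  have hK' : ContDiff ℝ ∞ (deriv K) := (contDiff_infty_iff_deriv.1 hK).2
  have hsecond : ∀ v : ℝ × E, dirDeriv v (dirDeriv v (planeWave K e)) = fun p =>
      (v.1 + inner ℝ v.2 e) ^ 2 • planeWave (deriv (deriv K)) e p := fun v => by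
    have hconst : ContDiff ℝ ∞ fun s => (v.1 + inner ℝ v.2 e) • deriv K s := contDiff_const.smul hK'
    rw [dirDeriv_planeWave hK, dirDeriv_planeWave hconst]
    funext p
    simp only [planeWave, deriv_fun_const_smul _ (hK'.differentiable (by simp) _), smul_smul, sq]
  refine (isSmoothWave_iff_sum_spaceDeriv b).2 ⟨contDiff_planeWave hK e, funext fun p => ?_⟩
  simp only [hsecond, zero_add, inner_zero_left, add_zero, ← Finset.sum_smul]
  rw [b.sum_sq_inner_right, he]

variable [FiniteDimensional ℝ E] [MeasurableSpace E] [BorelSpace E]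

theorem isSmoothWave_sphere_integral {f : (ℝ × E) × E → F} (hf : ContDiff ℝ ∞ f)
    (h : ∀ θ : Metric.sphere (0 : E) 1, IsSmoothWave fun p => f (p, θ)) :
    IsSmoothWave fun p => ∫ θ : Metric.sphere (0 : E) 1, f (p, θ) ∂surfaceMeasure E := by
  have b := stdOrthonormalBasis ℝ E
  have hsecond : ∀ v : ℝ × E, dirDeriv v (dirDeriv v fun p =>
      ∫ θ : Metric.sphere (0 : E) 1, f (p, θ) ∂surfaceMeasure E) = fun p =>
      ∫ θ : Metric.sphere (0 : E) 1, dirDeriv (v, 0) (dirDeriv (v, 0) f) (p, θ)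
        ∂surfaceMeasure E := fun v => by
    rw [dirDeriv_sphere_integral hf, dirDeriv_sphere_integral (contDiff_dirDeriv hf _)]
  have hslice : ∀ {f : (ℝ × E) × E → F}, ContDiff ℝ ∞ f → ∀ (v : ℝ × E) (y : E),
      dirDeriv v (fun p => f (p, y)) = fun p => dirDeriv (v, 0) f (p, y) := fun hf v y =>
    funext fun p => dirDeriv_comp hf (hasFDerivAt_prodMk_left p y) v
  refine (isSmoothWave_iff_sum_spaceDeriv b).2 ⟨contDiff_sphere_integral hf, funext fun p => ?_⟩
  simp only [hsecond]
  rw [← integral_finsetSum]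
  · refine integral_congr_ae (Eventually.of_forall fun θ => ?_)
    simpa only [hslice hf, hslice (contDiff_dirDeriv hf _)] using
      congr_fun ((h θ).timeDeriv_timeDeriv b) p
  · intro i _
    have hcont := (contDiff_dirDeriv (contDiff_dirDeriv hf (((0 : ℝ), b i), 0))
      (((0 : ℝ), b i), 0)).continuous
    exact integrable_sphere_of_continuous (by fun_prop)

/-- The superposition of the plane waves with profile `K` in all directions. -/
noncomputable def isotropicWave (K : ℝ → F) (p : ℝ × E) : F :=
  ∫ θ : Metric.sphere (0 : E) 1, planeWave K (θ : E) p ∂surfaceMeasure E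

theorem isSmoothWave_isotropicWave (hK : ContDiff ℝ ∞ K) :
    IsSmoothWave (isotropicWave K : ℝ × E → F) :=
  isSmoothWave_sphere_integral (contDiff_planeWave_uncurry hK) fun θ =>
    isSmoothWave_planeWave hK (norm_eq_of_mem_sphere θ)

theorem timeDeriv_isotropicWave (hK : ContDiff ℝ ∞ K) :
    ∂ₜ (isotropicWave K : ℝ × E → F) = isotropicWave (deriv K) := by
  have hf := contDiff_planeWave_uncurry (E := E) hK
  refine (dirDeriv_sphere_integral (μ := volume) hf _).trans (funext fun p => ?_)
  refine integral_congr_ae (Eventually.of_forall fun θ => ?_)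
  have hslice := dirDeriv_comp hf (hasFDerivAt_prodMk_left p (θ : E)) (1, 0)
  exact hslice.symm.trans ((congr_fun (dirDeriv_planeWave hK (θ : E) (1, 0)) p).trans
    (by simp [planeWave]))

variable [CompleteSpace F] [hdim : Fact (Module.finrank ℝ E = 3)]
include hdim

/-- Archimedes' formula: the sphere of `ℝ³` projects to the uniform density on an axis. -/
theorem smul_isotropicWave {g : ℝ → F} (hK : ContDiff ℝ ∞ K) (hg : ∀ s, HasDerivAt g (K s) s)
    {e : E} (he : ‖e‖ = 1) (t : ℝ) {r : ℝ} (hr : 0 ≤ r) :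
    r • isotropicWave K (t, r • e) =
      ((surfaceMeasure E).real Set.univ / 2) • (g (t + r) - g (t - r)) := by
  set κ := (surfaceMeasure E).real Set.univ
  -- By the symmetry of the inner product the left-hand side is also `r` times the integral over the
  -- sphere of a single plane wave, whose derivative along characteristics is known.
  set m := timeSphereMean (planeWave K e) 0
  have hwave := isSmoothWave_planeWave hK he
  have hm : ∀ t r, m (t, r) = isotropicWave K (t, r • e) := fun t r => by
    simp [m, timeSphereMean, sphereMean, isotropicWave, planeWave, inner_smul_left, real_inner_comm]
  have hderiv : ∀ x : ℝ, 0 ≤ x → HasDerivAt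
      (fun x : ℝ => x • m (t - r + x, x) - (κ / 2) • g (t - r + 2 * x)) 0 x := fun x hx => by
    have hcurve : HasDerivAt (fun s : ℝ => (t - r + s, s)) ((1 : ℝ), (1 : ℝ)) x :=
      ((hasDerivAt_id x).const_add _).prodMk (hasDerivAt_id x)
    have hline : HasDerivAt (fun s : ℝ => t - r + 2 * s) 2 x := by
      simpa using ((hasDerivAt_id x).const_mul 2).const_add (t - r)
    have hchar := hwave.sphereMean_characteristic 0 (t - r + 2 * x) hx
    rw [show t - r + 2 * x - x = t - r + x by ring] at hchar
    have hsplit : dirDeriv (1, 1) m (t - r + x, x) =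
        ∂ₜ m (t - r + x, x) + ∂ₓ[1] m (t - r + x, x) := by simp [dirDeriv, ← map_add]
    refine (((hasDerivAt_id x).smul (hasDerivAt_comp_curve
      (contDiff_timeSphereMean hwave.contDiff 0) hcurve)).sub
        (((hg _).scomp x hline).const_smul (κ / 2))).congr_deriv ?_
    have hK0 : planeWave K e (t - r + 2 * x, 0) = K (t - r + 2 * x) := by simp [planeWave]
    rw [hK0] at hchar
    rw [hsplit, smul_smul, div_mul_cancel₀ κ two_ne_zero, ← hchar]
    simp only [id_eq, one_smul, smul_add]
    abel
  have hconst := constant_of_has_deriv_right_zero (a := 0) (b := r)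
    (fun s hs => (hderiv s hs.1).continuousAt.continuousWithinAt)
    (fun s hs => (hderiv s hs.1).hasDerivWithinAt) r ⟨hr, le_rfl⟩
  rw [hm, sub_add_cancel, show t - r + 2 * r = t + r by ring] at hconst
  simp only [zero_smul, mul_zero, add_zero, zero_sub] at hconst
  rw [smul_sub, ← sub_add_cancel (r • isotropicWave K (t, r • e)) ((κ / 2) • g (t + r)), hconst]
  abel

theorem isotropicWave_eq {g : ℝ → F} (hK : ContDiff ℝ ∞ K) (hg : ∀ s, HasDerivAt g (K s) s) (t : ℝ)
    {z : E} (hz : z ≠ 0) : isotropicWave K (t, z) =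
      ‖z‖⁻¹ • ((surfaceMeasure E).real Set.univ / 2) • (g (t + ‖z‖) - g (t - ‖z‖)) := by
  have hn : ‖z‖ ≠ 0 := norm_ne_zero_iff.2 hz
  have h := smul_isotropicWave hK hg (e := ‖z‖⁻¹ • z)
    (by rw [norm_smul, norm_inv, norm_norm, inv_mul_cancel₀ hn]) t (norm_nonneg z)
  rw [smul_inv_smul₀ hn] at h
  rw [← h, inv_smul_smul₀ hn]

theorem isotropicWave_zero_eq_zero {g : ℝ → F} {b : ℝ} (hb : 0 ≤ b) (hK : ContDiff ℝ ∞ K)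
    (hg : ∀ s, HasDerivAt g (K s) s) (hgb : ∀ s, b < |s| → g s = 0) {z : E} (hz : b < ‖z‖) :
    isotropicWave K (0, z) = 0 := by
  rw [isotropicWave_eq hK hg 0 (norm_pos_iff.1 (hb.trans_lt hz)), zero_add, zero_sub,
    hgb _ (by rwa [abs_norm]), hgb _ (by rwa [abs_neg, abs_norm]), sub_zero, smul_zero, smul_zero]

theorem hasRadiationLimit_isotropicWave {b : ℝ} (hK : ContDiff ℝ ∞ K)
    (hKb : ∀ s, b < |s| → K s = 0) : HasRadiationLimit (∂ₜ (isotropicWave K : ℝ × E → F))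
      fun p => -((surfaceMeasure E).real Set.univ / 2) • K p.1 := fun s θ => by
  have hderiv : ∀ s, HasDerivAt K (deriv K s) s := fun s =>
    (hK.differentiable (by simp) s).hasDerivAt
  rw [timeDeriv_isotropicWave hK]
  refine tendsto_const_nhds.congr' ?_
  filter_upwards [eventually_ge_atTop 0, eventually_gt_atTop ((b - s) / 2)] with r hr hrb
  rw [smul_isotropicWave (contDiff_infty_iff_deriv.1 hK).2 hderiv (norm_eq_of_mem_sphere θ) _ hr,
    hKb (s + r + r) ((by linarith : b < s + r + r).trans_le (le_abs_self _)), add_sub_cancel_right,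
    zero_sub, smul_neg, neg_smul]

end PlaneWaves

section RadialData

theorem exists_compactly_supported_primitive {F : Type*} [NormedAddCommGroup F] [NormedSpace ℝ F]
    [CompleteSpace F] {K : ℝ → F} {b : ℝ} (hK : Continuous K) (hKb : ∀ s, b < |s| → K s = 0)
    (hmean : ∫ s, K s = 0) :
    ∃ g : ℝ → F, (∀ s, HasDerivAt g (K s) s) ∧ ∀ s, b < |s| → g s = 0 := by
  have h_int : Integrable K :=
    hK.integrable_of_hasCompactSupport (hasCompactSupport_of_eq_zero hKb)
  have htail : ∀ s, b < |s| → ∫ x in Set.Iic s, K x = 0 := fun s hs => by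
    rcases le_total s 0 with h0 | h0
    · refine setIntegral_eq_zero_of_forall_eq_zero fun x hx => hKb x (hs.trans_le ?_)
      exact abs_le_abs_of_nonpos h0 hx
    · rw [← hmean, ← intervalIntegral.integral_Iic_add_Ioi (b := s) h_int.integrableOn
        h_int.integrableOn, left_eq_add]
      refine setIntegral_eq_zero_of_forall_eq_zero fun x hx => hKb x (hs.trans_le ?_)
      exact abs_le_abs_of_nonneg h0 (Set.mem_Ioi.1 hx).le
  refine ⟨fun s => ∫ x in Set.Iic s, K x, fun s => ?_, htail⟩
  have hprim : (fun s => ∫ x in Set.Iic s, K x) =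
      fun s => (∫ x in Set.Iic 0, K x) + ∫ x in (0 : ℝ)..s, K x := funext fun s => by
    rw [← intervalIntegral.integral_Iic_sub_Iic h_int.integrableOn h_int.integrableOn,
      add_sub_cancel]
  rw [hprim]
  exact (hK.integral_hasStrictDerivAt 0 s).hasDerivAt.const_add _

theorem isTestFunction_isotropicWave {K g : ℝ → ℂ} {b : ℝ} (hb : 0 ≤ b) (hK : ContDiff ℝ ∞ K)
    (hg : ∀ s, HasDerivAt g (K s) s) (hgb : ∀ s, b < |s| → g s = 0) :
    IsTestFunction fun z => isotropicWave K (0, z) :=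
  ⟨contDiff_timeSlice (isSmoothWave_isotropicWave hK).contDiff 0,
    hasCompactSupport_of_eq_zero fun _ => isotropicWave_zero_eq_zero hb hK hg hgb⟩

theorem isRadial_isotropicWave {K g : ℝ → ℂ} (hK : ContDiff ℝ ∞ K)
    (hg : ∀ s, HasDerivAt g (K s) s) (t : ℝ) : IsRadial fun z => isotropicWave K (t, z) :=
  ⟨fun r => r⁻¹ • ((surfaceMeasure Space3).real Set.univ / 2) • (g (t + r) - g (t - r)),
    (Measure.ae_ne volume 0).mono fun _ hz => isotropicWave_eq hK hg t hz⟩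

theorem exists_radial_data {K : ℝ → ℂ} {b : ℝ} (hb : 0 ≤ b) (hK : ContDiff ℝ ∞ K)
    (hKb : ∀ s, b < |s| → K s = 0) (hmean : ∫ s, K s = 0) :
    ∃ φ ψ : Space3 → ℂ, IsTestFunction φ ∧ IsTestFunction ψ ∧
      IsClassicalRadiationField φ ψ (fun p => K p.1) ∧ IsRadial φ ∧ IsRadial ψ ∧
      (∀ z, b < ‖z‖ → φ z = 0) ∧ ∀ z, b < ‖z‖ → ψ z = 0 := by
  set c : ℝ := -((surfaceMeasure Space3).real Set.univ / 2)
  have hc : c ≠ 0 := neg_ne_zero.2 (half_pos (surfaceMeasure_real_univ_pos Space3)).ne'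
  obtain ⟨g, hg, hgb⟩ := exists_compactly_supported_primitive hK.continuous hKb hmean
  set L : ℝ → ℂ := c⁻¹ • K
  have hL : ContDiff ℝ ∞ L := contDiff_const.smul hK
  have hL' : ContDiff ℝ ∞ (deriv L) := (contDiff_infty_iff_deriv.1 hL).2
  have hcg : ∀ s, HasDerivAt (c⁻¹ • g) (L s) s := fun s => (hg s).const_smul c⁻¹
  have hLd : ∀ s, HasDerivAt L (deriv L s) s := fun s =>
    (hL.differentiable (by simp) s).hasDerivAt
  have hcgb : ∀ s, b < |s| → (c⁻¹ • g) s = 0 := fun s hs => by simp [hgb s hs]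
  have hLb : ∀ s, b < |s| → L s = 0 := fun s hs => by simp [L, hKb s hs]
  have hlimit : HasRadiationLimit (∂ₜ (isotropicWave L)) fun p : ℝ × Sphere2 => c • L p.1 :=
    hasRadiationLimit_isotropicWave hL hLb
  have hcL : ∀ s, c • L s = K s := fun s => smul_inv_smul₀ hc (K s)
  simp only [hcL] at hlimit
  exact ⟨fun z => isotropicWave L (0, z), fun z => isotropicWave (deriv L) (0, z),
    isTestFunction_isotropicWave hb hL hcg hcgb, isTestFunction_isotropicWave hb hL' hLd hLb,
    isClassicalRadiationField_iff.2 ⟨_, isSmoothWave_isotropicWave hL, fun _ => rfl,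
      fun _ => by rw [timeDeriv_isotropicWave hL], hlimit⟩,
    isRadial_isotropicWave hL hcg 0, isRadial_isotropicWave hL' hLd 0,
    fun _ => isotropicWave_zero_eq_zero hb hL hcg hcgb,
    fun _ => isotropicWave_zero_eq_zero hb hL' hLd hLb⟩

end RadialData

section Approximation

variable {E F : Type*} [NormedAddCommGroup E] [NormedSpace ℝ E] [FiniteDimensional ℝ E]
  [MeasurableSpace E] [BorelSpace E] [NormedAddCommGroup F] [NormedSpace ℝ F]
  {μ : Measure E} {f : E → F} {p : ENNReal} {r b : ℝ}

theorem exists_contDiff_support_ball_eLpNorm_sub_le [IsFiniteMeasureOnCompacts μ] (hp : 1 ≤ p)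
    (hp_top : p ≠ ⊤) (hf : MemLp f p μ) (hb : 0 < b) (hrb : r < b)
    (hsupp : ∀ᵐ z ∂μ, r < ‖z‖ → f z = 0) {ε : ℝ} (hε : 0 < ε) :
    ∃ k : E → F, ContDiff ℝ ∞ k ∧ (∀ z, b < ‖z‖ → k z = 0) ∧
      eLpNorm (fun z => k z - f z) p μ ≤ ENNReal.ofReal ε := by
  obtain ⟨k, -, hk, hkf⟩ := hf.exist_eLpNorm_sub_le hp_top hp hε
  let η : ContDiffBump (0 : E) := ⟨max r (b / 2), b, by positivity, max_lt hrb (by linarith)⟩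
  have hηf : ∀ᵐ z ∂μ, η z • f z = f z := hsupp.mono fun z hz => by
    rcases le_or_gt ‖z‖ r with hle | hlt
    · rw [η.one_of_mem_closedBall (mem_closedBall_zero_iff.2 (hle.trans (le_max_left _ _))),
        one_smul]
    · rw [hz hlt, smul_zero]
  refine ⟨fun z => η z • k z, η.contDiff.smul hk, fun z hz => ?_, ?_⟩
  · simp only [η.zero_of_le_dist (by simpa using hz.le), zero_smul]
  · refine le_trans (eLpNorm_mono_ae (hηf.mono fun z hz => ?_))
      ((eLpNorm_sub_comm k f p μ).trans_le hkf)
    calc ‖η z • k z - f z‖ = η z * ‖k z - f z‖ := by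
          rw [← hz, ← smul_sub, norm_smul, Real.norm_of_nonneg η.nonneg, hz]
      _ ≤ ‖(k - f) z‖ := mul_le_of_le_one_left (norm_nonneg _) η.le_one

theorem enorm_integral_le_mul_eLpNorm_sub [IsFiniteMeasureOnCompacts μ] {q : ENNReal}
    [p.HolderConjugate q] {k : E → F} (hk : MemLp k p μ) (hf : MemLp f p μ)
    (hk0 : ∀ z, b < ‖z‖ → k z = 0) (hf0 : ∀ᵐ z ∂μ, b < ‖z‖ → f z = 0) (hmean : ∫ z, f z ∂μ = 0) :
    ‖∫ z, k z ∂μ‖ₑ ≤ eLpNorm ((Metric.closedBall (0 : E) b).indicator fun _ => (1 : ℝ)) q μ *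
      eLpNorm (fun z => k z - f z) p μ := by
  set χ : E → ℝ := (Metric.closedBall (0 : E) b).indicator fun _ => 1
  have hχ : MemLp χ q μ := memLp_indicator_const q Metric.isClosed_closedBall.measurableSet 1
    (Or.inr (isCompact_closedBall 0 b).measure_lt_top.ne)
  have hχ_smul : ∀ {z} {w : F}, (b < ‖z‖ → w = 0) → χ z • w = w := fun {z w} hw => by
    by_cases hz : z ∈ Metric.closedBall (0 : E) b
    · simp only [χ, Set.indicator_of_mem hz, one_smul]
    · rw [hw (by simpa using hz), smul_zero]
  have h_int : ∀ {g : E → F}, MemLp g p μ → Integrable (fun z => χ z • g z) μ := fun hg =>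
    memLp_one_iff_integrable.1 (hg.smul hχ)
  have hkf : ∫ z, k z ∂μ = ∫ z, χ z • (k z - f z) ∂μ := by
    have hf_int : ∫ z, χ z • f z ∂μ = 0 := by
      rw [← hmean]
      exact integral_congr_ae (hf0.mono fun z hz => hχ_smul hz)
    simp only [smul_sub]
    rw [integral_sub (h_int hk) (h_int hf), hf_int, sub_zero]
    exact integral_congr_ae (.of_forall fun z => (hχ_smul (hk0 z)).symm)
  rw [hkf]
  exact enorm_integral_smul_le_eLpNorm_mul hχ.aestronglyMeasurable
    (hk.sub hf).aestronglyMeasurable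

omit [NormedAddCommGroup E] [NormedSpace ℝ E] [FiniteDimensional ℝ E] [BorelSpace E] in
theorem eLpNorm_smul_const_le (ρ : E → ℝ) (m : F) :
    eLpNorm (fun z => ρ z • m) p μ ≤ ‖m‖ₑ * eLpNorm ρ p μ :=
  eLpNorm_le_nnreal_smul_eLpNorm_of_ae_le_mul
    (.of_forall fun z => (nnnorm_smul (ρ z) m).trans (mul_comm _ _) |>.le) p

theorem eLpNorm_sub_smul_integral_sub_le [IsFiniteMeasureOnCompacts μ] (hp : 1 ≤ p)
    {q : ENNReal} [p.HolderConjugate q] {k : E → F} {ρ : E → ℝ} (hρ : AEStronglyMeasurable ρ μ)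
    (hk : MemLp k p μ) (hf : MemLp f p μ) (hk0 : ∀ z, b < ‖z‖ → k z = 0)
    (hf0 : ∀ᵐ z ∂μ, b < ‖z‖ → f z = 0) (hmean : ∫ z, f z ∂μ = 0) :
    eLpNorm (fun z => k z - ρ z • ∫ y, k y ∂μ - f z) p μ ≤ eLpNorm (fun z => k z - f z) p μ *
      (1 + eLpNorm ((Metric.closedBall (0 : E) b).indicator fun _ => (1 : ℝ)) q μ *
        eLpNorm ρ p μ) := by
  set C := eLpNorm ((Metric.closedBall (0 : E) b).indicator fun _ => (1 : ℝ)) q μ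
  set m := ∫ z, k z ∂μ
  have hcomm : (fun z => k z - ρ z • m - f z) = (fun z => k z - f z) - fun z => ρ z • m :=
    funext fun z => sub_right_comm _ _ _
  calc eLpNorm (fun z => k z - ρ z • m - f z) p μ
      ≤ eLpNorm (fun z => k z - f z) p μ + eLpNorm (fun z => ρ z • m) p μ := by
        rw [hcomm]
        exact eLpNorm_sub_le (hk.sub hf).aestronglyMeasurable (hρ.smul_const m) hp
    _ ≤ eLpNorm (fun z => k z - f z) p μ +
          C * eLpNorm (fun z => k z - f z) p μ * eLpNorm ρ p μ := by
        gcongr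
        refine (eLpNorm_smul_const_le ρ m).trans ?_
        gcongr
        exact enorm_integral_le_mul_eLpNorm_sub hk hf hk0 hf0 hmean
    _ = _ := by ring

/-- The mean of an approximation `k` of `f` is at most a constant times the error, so it can be
removed by subtracting a multiple of a fixed bump. -/
theorem exists_contDiff_integral_eq_zero_eLpNorm_sub_le [CompleteSpace F] [μ.IsAddHaarMeasure]
    (hp : 1 ≤ p) (hp_top : p ≠ ⊤) (hf : MemLp f p μ) (hb : 0 < b) (hrb : r < b)
    (hsupp : ∀ᵐ z ∂μ, r < ‖z‖ → f z = 0) (hmean : ∫ z, f z ∂μ = 0) {ε : ENNReal} (hε : ε ≠ 0) :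
    ∃ k : E → F, ContDiff ℝ ∞ k ∧ (∀ z, b < ‖z‖ → k z = 0) ∧ ∫ z, k z ∂μ = 0 ∧
      eLpNorm (fun z => k z - f z) p μ ≤ ε := by
  let η : ContDiffBump (0 : E) := ⟨b / 2, b, by positivity, by linarith⟩
  set ρ : E → ℝ := η.normed μ
  have hρ : ContDiff ℝ ∞ ρ := η.contDiff_normed
  have hρc : HasCompactSupport ρ := η.hasCompactSupport_normed
  have hρp : MemLp ρ p μ := hρ.continuous.memLp_of_hasCompactSupport hρc
  have hρ0 : ∀ z, b < ‖z‖ → ρ z = 0 := fun z hz => by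
    rw [← Function.notMem_support, η.support_normed_eq]
    simpa using hz.le
  have : p.HolderConjugate p.conjExponent := .conjExponent hp
  have hχ : MemLp ((Metric.closedBall (0 : E) b).indicator fun _ => (1 : ℝ)) p.conjExponent μ :=
    memLp_indicator_const _ Metric.isClosed_closedBall.measurableSet 1
      (Or.inr (isCompact_closedBall 0 b).measure_lt_top.ne)
  obtain ⟨e, he, heε⟩ := ENNReal.exists_nnreal_pos_mul_lt
    (ENNReal.add_ne_top.2 ⟨ENNReal.one_ne_top, ENNReal.mul_ne_top hχ.eLpNorm_ne_top
      hρp.eLpNorm_ne_top⟩) hε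
  obtain ⟨k, hk, hk0, hkf⟩ :=
    exists_contDiff_support_ball_eLpNorm_sub_le hp hp_top hf hb hrb hsupp (NNReal.coe_pos.2 he)
  have hkc : HasCompactSupport k := hasCompactSupport_of_eq_zero hk0
  have hf0 : ∀ᵐ z ∂μ, b < ‖z‖ → f z = 0 := hsupp.mono fun z hz hbz => hz (hrb.trans hbz)
  refine ⟨fun z => k z - ρ z • ∫ y, k y ∂μ, hk.sub (hρ.smul contDiff_const), fun z hz => ?_, ?_, ?_⟩
  · simp only [hk0 z hz, hρ0 z hz, zero_smul, sub_zero]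
  · rw [integral_sub (hk.continuous.integrable_of_hasCompactSupport hkc)
      ((hρ.continuous.integrable_of_hasCompactSupport hρc).smul_const _), integral_smul_const,
      η.integral_normed, one_smul, sub_self]
  · refine (eLpNorm_sub_smul_integral_sub_le (q := p.conjExponent) hp hρp.aestronglyMeasurable
      (hk.continuous.memLp_of_hasCompactSupport hkc) hf hk0 hf0 hmean).trans (le_trans ?_ heε.le)
    gcongr
    exact hkf.trans_eq ENNReal.ofReal_coe_nnreal

end Approximation

section LpLimits

theorem exists_tendsto_eLpNorm_sub_of_cauchy {X F : Type*} [MeasurableSpace X]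
    [NormedAddCommGroup F] [CompleteSpace F] {μ : Measure X} {p : ENNReal} (hp : 1 ≤ p)
    {f : ℕ → X → F} (hf : ∀ n, MemLp (f n) p μ)
    (hcauchy : Tendsto (fun n : ℕ × ℕ => eLpNorm (fun x => f n.1 x - f n.2 x) p μ) atTop (𝓝 0)) :
    ∃ g, MemLp g p μ ∧ Tendsto (fun n => eLpNorm (fun x => f n x - g x) p μ) atTop (𝓝 0) := by
  have : Fact (1 ≤ p) := ⟨hp⟩
  have hcauchySeq : CauchySeq fun n => (hf n).toLp (f n) := by
    rw [Lp.cauchySeq_Lp_iff_cauchySeq_eLpNorm]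
    exact hcauchy.congr fun n =>
      eLpNorm_congr_ae ((hf n.1).coeFn_toLp.sub (hf n.2).coeFn_toLp).symm
  obtain ⟨g, hg⟩ := cauchySeq_tendsto_of_complete hcauchySeq
  refine ⟨g, Lp.memLp g, (Lp.tendsto_Lp_iff_tendsto_eLpNorm'' f hf g (Lp.memLp g)).1 ?_⟩
  rwa [Lp.toLp_coeFn]

theorem tendsto_integral_smul_of_tendsto_eLpNorm {X F 𝕜 ι : Type*} [MeasurableSpace X]
    [NormedAddCommGroup F] [NormedSpace ℝ F] [NormedField 𝕜] [NormedSpace 𝕜 F] {μ : Measure X}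
    {p q : ENNReal} [p.HolderConjugate q] {l : Filter ι} {χ : X → 𝕜} (hχ : MemLp χ p μ)
    {f : ι → X → F} {g : X → F} (hf : ∀ n, MemLp (f n) q μ) (hg : MemLp g q μ)
    (h : Tendsto (fun n => eLpNorm (fun x => f n x - g x) q μ) l (𝓝 0)) :
    Tendsto (fun n => ∫ x, χ x • f n x ∂μ) l (𝓝 (∫ x, χ x • g x ∂μ)) := by
  have h_int : ∀ {k : X → F}, MemLp k q μ → Integrable (fun x => χ x • k x) μ := fun hk =>
    memLp_one_iff_integrable.1 (hk.smul hχ)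
  have hbound : Tendsto (fun n => eLpNorm χ p μ * eLpNorm (fun x => f n x - g x) q μ) l (𝓝 0) := by
    simpa using ENNReal.Tendsto.const_mul h (Or.inr hχ.eLpNorm_ne_top)
  refine tendsto_iff_edist_tendsto_0.2 (tendsto_of_tendsto_of_tendsto_of_le_of_le
    tendsto_const_nhds hbound (fun n => zero_le) fun n => ?_)
  simp only [edist_eq_enorm_sub, ← integral_sub (h_int (hf n)) (h_int hg), ← smul_sub]
  exact enorm_integral_smul_le_eLpNorm_mul hχ.aestronglyMeasurable
    ((hf n).sub hg).aestronglyMeasurable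

theorem ae_eq_zero_of_tendsto_eLpNorm {E F : Type*} [MeasurableSpace E] [Norm E]
    [NormedAddCommGroup F] {μ : Measure E} {p : ENNReal} (hp : p ≠ 0) {f : ℕ → E → F} {g : E → F}
    (hf : ∀ n, AEStronglyMeasurable (f n) μ) (hg : AEStronglyMeasurable g μ)
    (h : Tendsto (fun n => eLpNorm (fun z => f n z - g z) p μ) atTop (𝓝 0)) {R : ℝ} {b : ℕ → ℝ}
    (hb : Tendsto b atTop (𝓝 R)) (hfb : ∀ n z, b n < ‖z‖ → f n z = 0) :
    ∀ᵐ z ∂μ, R < ‖z‖ → g z = 0 := by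
  obtain ⟨ns, hns, hlim⟩ :=
    (tendstoInMeasure_of_tendsto_eLpNorm hp hf hg h).exists_seq_tendsto_ae
  filter_upwards [hlim] with z hz hRz
  refine tendsto_nhds_unique hz (tendsto_const_nhds.congr' ?_)
  filter_upwards [(hb.comp hns.tendsto_atTop).eventually_lt_const hRz] with i hi
  exact (hfb _ _ hi).symm

theorem eLpNorm_comp_fst_prod {X Y F : Type*} [MeasurableSpace X] [MeasurableSpace Y]
    [NormedAddCommGroup F] {μ : Measure X} {ν : Measure Y} [SFinite ν] {p : ENNReal}
    (hp_top : p ≠ ⊤) {k : X → F} (hk : AEStronglyMeasurable k μ) :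
    eLpNorm (fun x : X × Y => k x.1) p (μ.prod ν) =
      ν Set.univ ^ (1 / p).toReal * eLpNorm k p μ := by
  have h := eLpNorm_map_measure (p := p) (f := (Prod.fst : X × Y → X)) (g := k) (μ := μ.prod ν)
    (by rw [Measure.map_fst_prod]; exact hk.smul_measure _) measurable_fst.aemeasurable
  rw [Measure.map_fst_prod, eLpNorm_smul_measure_of_ne_top hp_top, smul_eq_mul] at h
  exact h.symm

theorem tendsto_eLpNorm_comp_fst_prod {X Y F ι : Type*} [MeasurableSpace X] [MeasurableSpace Y]
    [NormedAddCommGroup F] {μ : Measure X} {ν : Measure Y} [IsFiniteMeasure ν]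
    {p : ENNReal} (hp_top : p ≠ ⊤) {l : Filter ι} {k : ι → X → F}
    (hk : ∀ n, AEStronglyMeasurable (k n) μ) (h : Tendsto (fun n => eLpNorm (k n) p μ) l (𝓝 0)) :
    Tendsto (fun n => eLpNorm (fun x : X × Y => k n x.1) p (μ.prod ν)) l (𝓝 0) := by
  have hν : ν Set.univ ^ (1 / p).toReal ≠ ⊤ :=
    ENNReal.rpow_ne_top_of_nonneg ENNReal.toReal_nonneg (measure_ne_top ν Set.univ)
  simp only [eLpNorm_comp_fst_prod hp_top (hk _)]
  simpa only [mul_zero] using ENNReal.Tendsto.const_mul h (Or.inr hν)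

end LpLimits

section Existence

variable {f : ℕ → Space3 → ℂ} {g : Space3 → ℂ} {p : ENNReal}

theorem IsRadial.of_tendsto_eLpNorm (hp : p ≠ 0) (hf : ∀ n, AEStronglyMeasurable (f n) volume)
    (hg : AEStronglyMeasurable g volume)
    (h : Tendsto (fun n => eLpNorm (fun z => f n z - g z) p volume) atTop (𝓝 0))
    (hradial : ∀ n, IsRadial (f n)) : IsRadial g := by
  obtain ⟨ns, -, hlim⟩ := (tendstoInMeasure_of_tendsto_eLpNorm hp hf hg h).exists_seq_tendsto_ae
  choose k hk using hradial
  refine ⟨fun r => limUnder atTop fun i => k (ns i) r, ?_⟩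
  filter_upwards [hlim, ae_all_iff.2 hk] with z hz hkz
  simp only [hkz] at hz
  exact hz.limUnder_eq.symm

theorem IsRadial.congr {φ φ' : Space3 → ℂ} (h : IsRadial φ) (hφ : φ =ᵐ[volume] φ') :
    IsRadial φ' := by
  obtain ⟨k, hk⟩ := h
  exact ⟨k, hφ.symm.trans hk⟩

theorem IsTestFunction.integral_gradient3_mul {φ χ : Space3 → ℂ} (hφ : IsTestFunction φ)
    (hχ : IsTestFunction χ) (i : Fin 3) :
    ∫ z, gradient3 χ z i * φ z = -∫ z, χ z * gradient3 φ z i := by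
  have h := integral_bilin_dirDeriv (μ := volume) (ContinuousLinearMap.mul ℝ ℂ) hφ.1 hχ.1 hφ.2
    (EuclideanSpace.basisFun (Fin 3) ℝ i)
  simpa only [gradient3_apply, ContinuousLinearMap.mul_apply', mul_comm] using h

theorem HasWeakGradient.of_tendsto_eLpNorm {q : ENNReal} (hp : 1 ≤ p) (hq : 1 ≤ q)
    {G : Space3 → EuclideanSpace ℂ (Fin 3)} (hf : ∀ n, IsTestFunction (f n)) (hg : MemLp g p volume)
    (hG : MemLp G q volume)
    (hfg : Tendsto (fun n => eLpNorm (fun z => f n z - g z) p volume) atTop (𝓝 0))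
    (hgrad : Tendsto (fun n => eLpNorm (fun z => gradient3 (f n) z - G z) q volume) atTop (𝓝 0)) :
    HasWeakGradient g G where
  locallyIntegrable := hg.locallyIntegrable hp
  locallyIntegrable_grad := hG.locallyIntegrable hq
  integral_eq χ hχ i := by
    have hcoord : ∀ {k : Space3 → EuclideanSpace ℂ (Fin 3)} {r : ENNReal}, MemLp k r volume →
        MemLp (fun z => k z i) r volume := fun hk =>
      hk.of_le ((EuclideanSpace.proj i).continuous.comp_aestronglyMeasurable
        hk.aestronglyMeasurable) (.of_forall fun z => PiLp.norm_apply_le _ i)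
    have hgradi : Tendsto (fun n => eLpNorm (fun z => gradient3 (f n) z i - G z i) q volume)
        atTop (𝓝 0) :=
      tendsto_of_tendsto_of_tendsto_of_le_of_le tendsto_const_nhds hgrad (fun n => zero_le)
        fun n => eLpNorm_mono fun z => PiLp.norm_apply_le (gradient3 (f n) z - G z) i
    have := (ENNReal.HolderConjugate.conjExponent hp).symm
    have := (ENNReal.HolderConjugate.conjExponent hq).symm
    have hleft := tendsto_integral_smul_of_tendsto_eLpNorm
      (hcoord (hχ.memLp_gradient3 p.conjExponent)) (fun n => (hf n).memLp p) hg hfg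
    have hright := tendsto_integral_smul_of_tendsto_eLpNorm (hχ.memLp q.conjExponent)
      (fun n => hcoord ((hf n).memLp_gradient3 q)) (hcoord hG) hgradi
    have heq := tendsto_nhds_unique hleft
      (hright.neg.congr fun n => ((hf n).integral_gradient3_mul hχ i).symm)
    simpa only [smul_eq_mul, mul_comm] using heq

theorem norm_fderiv_le_three_mul_norm_gradient3 (φ : Space3 → ℂ) (z : Space3) :
    ‖fderiv ℝ φ z‖ ≤ 3 * ‖gradient3 φ z‖ := by
  refine ContinuousLinearMap.opNorm_le_bound _ (by positivity) fun y => ?_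
  have hy := (EuclideanSpace.basisFun (Fin 3) ℝ).sum_repr y
  calc ‖fderiv ℝ φ z y‖ = ‖∑ i, y i • gradient3 φ z i‖ := by
        simp only [gradient3_apply, dirDeriv]
        conv_lhs => rw [← hy, map_sum]
        simp only [map_smul, EuclideanSpace.basisFun_repr]
    _ ≤ ∑ _i : Fin 3, ‖y‖ * ‖gradient3 φ z‖ := (norm_sum_le _ _).trans <| by
        refine Finset.sum_le_sum fun i _ => (norm_smul_le _ _).trans ?_
        gcongr <;> exact PiLp.norm_apply_le _ i
    _ = 3 * ‖gradient3 φ z‖ * ‖y‖ := by simp; ring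

theorem exists_eLpNorm_six_le_mul_eLpNorm_gradient3 : ∃ C : NNReal, ∀ φ : Space3 → ℂ,
    IsTestFunction φ → eLpNorm φ 6 volume ≤ C * eLpNorm (gradient3 φ) 2 volume := by
  refine ⟨SNormLESNormFDerivOfEqConst ℂ (volume : Measure Space3) 2 * 3, fun φ hφ => ?_⟩
  have hsobolev := eLpNorm_le_eLpNorm_fderiv_of_eq (volume : Measure Space3) (u := φ) (p := 2)
    (p' := 6) (hφ.1.of_le (by simp)) hφ.2 (by norm_num) (by simp) (by norm_num)
  have hfderiv := eLpNorm_le_nnreal_smul_eLpNorm_of_ae_le_mul (μ := volume) (c := 3)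
    (.of_forall (norm_fderiv_le_three_mul_norm_gradient3 φ)) 2
  rw [ENNReal.coe_mul, mul_assoc]
  exact hsobolev.trans (mul_le_mul_right hfderiv _)

/-- The energy bound makes the data of a convergent sequence of radiation fields a Cauchy
sequence in energy, and Sobolev's inequality turns this into convergence of `φn` in `L⁶`. -/
theorem exists_isRadiationField_of_tendsto {φn ψn : ℕ → Space3 → ℂ}
    {Gn : ℕ → ℝ × Sphere2 → ℂ} {G : ℝ × Sphere2 → ℂ}
    (htest : ∀ n, IsTestFunction (φn n) ∧ IsTestFunction (ψn n))
    (hclass : ∀ n, IsClassicalRadiationField (φn n) (ψn n) (Gn n))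
    (hG : MemLp G 2 cylinderMeasure)
    (hGn : Tendsto (fun n => eLpNorm (fun p => Gn n p - G p) 2 cylinderMeasure) atTop (𝓝 0)) :
    ∃ φ ψ, IsRadiationField φ ψ G ∧
      Tendsto (fun n => eLpNorm (fun z => φn n z - φ z) 6 volume) atTop (𝓝 0) ∧
      Tendsto (fun n => eLpNorm (fun z => ψn n z - ψ z) 2 volume) atTop (𝓝 0) := by
  have hGm := fun n => (hclass n).measurable.aestronglyMeasurable (μ := cylinderMeasure)
  have hGn' := hGn.congr fun n => eLpNorm_sub_comm (Gn n) G 2 cylinderMeasure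
  have hcauchy := tendsto_eLpNorm_sub_trans one_le_two (fun n : ℕ × ℕ => hGm n.1)
    (fun _ => hG.aestronglyMeasurable) (fun n => hGm n.2) (hGn.comp tendsto_fst)
    (hGn'.comp tendsto_snd)
  rw [prod_atTop_atTop_eq] at hcauchy
  obtain ⟨hgradn, hψn⟩ := tendsto_eLpNorm_sub_of_radiationField (fun n : ℕ × ℕ => htest n.1)
    (fun n => htest n.2) (fun n => hclass n.1) (fun n => hclass n.2) hcauchy
  have hφn : Tendsto (fun n : ℕ × ℕ => eLpNorm (fun z => φn n.1 z - φn n.2 z) 6 volume) atTop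
      (𝓝 0) := by
    obtain ⟨C, hC⟩ := exists_eLpNorm_six_le_mul_eLpNorm_gradient3
    refine tendsto_of_tendsto_of_tendsto_of_le_of_le tendsto_const_nhds
      (by simpa using ENNReal.Tendsto.const_mul hgradn (Or.inr (ENNReal.coe_ne_top (r := C))))
      (fun n => zero_le) fun n => ?_
    have hsobolev := hC _ ((htest n.1).1.sub (htest n.2).1)
    rwa [gradient3_sub (htest n.1).1.1 (htest n.2).1.1] at hsobolev
  obtain ⟨ψ, hψ, hψlim⟩ :=
    exists_tendsto_eLpNorm_sub_of_cauchy one_le_two (fun n => (htest n).2.memLp 2) hψn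
  obtain ⟨g, hg, hglim⟩ :=
    exists_tendsto_eLpNorm_sub_of_cauchy one_le_two (fun n => (htest n).1.memLp_gradient3 2) hgradn
  obtain ⟨φ, hφ, hφlim⟩ :=
    exists_tendsto_eLpNorm_sub_of_cauchy (by norm_num) (fun n => (htest n).1.memLp 6) hφn
  have hweak := HasWeakGradient.of_tendsto_eLpNorm (by norm_num) one_le_two (fun n => (htest n).1)
    hφ hg hφlim hglim
  exact ⟨φ, ψ, ⟨⟨⟨hφ, g, hweak, hg⟩, hψ⟩, hG, φn, ψn, Gn, htest, ⟨⟨g, hweak, hg, hglim⟩, hψlim⟩,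
    hclass, hGn⟩, hφlim, hψlim⟩

theorem exists_radial_isRadiationField {F : ℝ → ℂ} (hF : MemLp F 2 volume) {R : ℝ} (hR : 0 ≤ R)
    (hsupp : ∀ᵐ s : ℝ, R < |s| → F s = 0) (hmean : ∫ s, F s = 0) :
    ∃ φ ψ : Space3 → ℂ, IsRadiationField φ ψ (fun p => F p.1) ∧ IsRadial φ ∧ IsRadial ψ ∧
      (∀ᵐ z, R < ‖z‖ → φ z = 0) ∧ ∀ᵐ z, R < ‖z‖ → ψ z = 0 := by
  set b : ℕ → ℝ := fun n => R + 1 / ((n : ℝ) + 1)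
  have hRb : ∀ n, R < b n := fun n => lt_add_of_pos_right R (by positivity)
  have hb : ∀ n, 0 < b n := fun n => hR.trans_lt (hRb n)
  have hblim : Tendsto b atTop (𝓝 R) := by
    simpa only [add_zero] using
      (tendsto_one_div_add_atTop_nhds_zero_nat (𝕜 := ℝ)).const_add R
  choose K hK hKb hKmean hKF using fun n : ℕ =>
    exists_contDiff_integral_eq_zero_eLpNorm_sub_le one_le_two ENNReal.ofNat_ne_top hF (hb n)
      (hRb n) hsupp hmean (ENNReal.inv_ne_zero.2 (ENNReal.natCast_ne_top n))
  choose φn ψn hφn hψn hclass hφrad hψrad hφ0 hψ0 using fun n =>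
    exists_radial_data (hb n).le (hK n) (hKb n) (hKmean n)
  have hKlim : Tendsto (fun n => eLpNorm (fun s => K n s - F s) 2 volume) atTop (𝓝 0) :=
    tendsto_of_tendsto_of_tendsto_of_le_of_le tendsto_const_nhds ENNReal.tendsto_inv_nat_nhds_zero
      (fun n => zero_le) hKF
  have hGn : Tendsto (fun n => eLpNorm (fun p : ℝ × Sphere2 => K n p.1 - F p.1) 2 cylinderMeasure)
      atTop (𝓝 0) :=
    tendsto_eLpNorm_comp_fst_prod (k := fun n s => K n s - F s) ENNReal.ofNat_ne_top (fun n =>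
      (hK n).continuous.aestronglyMeasurable.sub hF.aestronglyMeasurable) hKlim
  obtain ⟨φ, ψ, h, hφ, hψ⟩ := exists_isRadiationField_of_tendsto (fun n => ⟨hφn n, hψn n⟩) hclass
    (hF.comp_fst _) hGn
  have hφm := h.1.1.1.aestronglyMeasurable
  have hψm := h.1.2.aestronglyMeasurable
  have hφnm := fun n => (hφn n).continuous.aestronglyMeasurable (μ := volume)
  have hψnm := fun n => (hψn n).continuous.aestronglyMeasurable (μ := volume)
  exact ⟨φ, ψ, h, .of_tendsto_eLpNorm (by norm_num) hφnm hφm hφ hφrad,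
    .of_tendsto_eLpNorm two_ne_zero hψnm hψm hψ hψrad,
    ae_eq_zero_of_tendsto_eLpNorm (by norm_num) hφnm hφm hφ hblim hφ0,
    ae_eq_zero_of_tendsto_eLpNorm two_ne_zero hψnm hψm hψ hblim hψ0⟩

theorem ae_le_norm_imp_of_ae_max_lt_norm_imp {E : Type*} [NormedAddCommGroup E] [NormedSpace ℝ E]
    [Nontrivial E] [FiniteDimensional ℝ E] [MeasurableSpace E] [BorelSpace E] {μ : Measure E}
    [μ.IsAddHaarMeasure] {R : ℝ} {P : E → Prop} (h : ∀ᵐ z ∂μ, max R 0 < ‖z‖ → P z) :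
    ∀ᵐ z ∂μ, R ≤ ‖z‖ → P z := by
  have hsphere : ∀ᵐ z ∂μ, z ∉ Metric.sphere (0 : E) (max R 0) :=
    measure_eq_zero_iff_ae_notMem.1 (Measure.addHaar_sphere μ 0 (max R 0))
  filter_upwards [h, hsphere] with z hz hne hR
  exact hz ((max_le hR (norm_nonneg z)).lt_of_ne' (by simpa using hne))

end Existence

theorem mainTheorem11 (F : ℝ → ℂ) (hF : MemLp F 2 volume) (R : ℝ)
    (hsupp : ∀ᵐ s : ℝ, R < |s| → F s = 0) (hmean : ∫ s : ℝ, F s = 0) :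
    (∃ φ ψ : Space3 → ℂ, IsRadiationField φ ψ (fun p => F p.1)) ∧
    ∀ φ ψ : Space3 → ℂ, IsRadiationField φ ψ (fun p => F p.1) →
      IsRadial φ ∧ IsRadial ψ ∧ FiniteEnergy φ ψ ∧
      (∀ᵐ z : Space3, R ≤ ‖z‖ → φ z = 0) ∧ (∀ᵐ z : Space3, R ≤ ‖z‖ → ψ z = 0) := by
  have hsupp' : ∀ᵐ s : ℝ, max R 0 < |s| → F s = 0 :=
    hsupp.mono fun s hs hRs => hs ((le_max_left R 0).trans_lt hRs)
  obtain ⟨φ₀, ψ₀, h₀, hφ₀, hψ₀, hφ₀_zero, hψ₀_zero⟩ :=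
    exists_radial_isRadiationField hF (le_max_right R 0) hsupp' hmean
  refine ⟨⟨φ₀, ψ₀, h₀⟩, fun φ ψ h => ?_⟩
  obtain ⟨hφ, hψ⟩ := h.ae_unique h₀
  refine ⟨hφ₀.congr hφ.symm, hψ₀.congr hψ.symm, h.1,
    ae_le_norm_imp_of_ae_max_lt_norm_imp ?_, ae_le_norm_imp_of_ae_max_lt_norm_imp ?_⟩
  · filter_upwards [hφ, hφ₀_zero] with z hz hz₀ hR using hz.trans (hz₀ hR)
  · filter_upwards [hψ, hψ₀_zero] with z hz hz₀ hR using hz.trans (hz₀ hR)
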